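/- Let $\mathsf X\subseteq\mathbb R^d$ be open and $K\subseteq\mathsf X$ compact and convex. Let $f:\mathsf X\to\mathbb R$ be continuously differentiable, and let $g:\mathsf X\to\mathbb R$ be locally Lipschitz, bounded from below and regular. Here, for $x\in\mathsf X$ and $h\in\mathbb R^d$, $$g^0(x,h)=\lim_{\delta\downarrow0}\ \sup_{\|\tilde h\|\le\delta,\;0<\lambda<\delta}\frac{g(x+\tilde h+\lambda h)-g(x+\tilde h)}{\lambda},$$ and $g$ is regular if for all $x\in\mathsf X$, $h\in\mathbb R^d$ the limit $\lim_{\lambda\downarrow0}(g(x+\lambda h)-g(x))/\lambda$ exists and equals $g^0(x,h)$. Let $\bar\partial g(x)=\{\zeta\in\mathbb R^d: \langle h,\zeta\rangle\le g^0(x,h)\text{ for all }h\in\mathbb R^d\}$ be the Clarke gradient, and for $x\in K$ let $N_K(x)=\{v\in\mathbb R^d:\langle v,z-x\rangle\le0\text{ for all }z\in K\}$ be the normal cone. Put $$\mathcal S=\{x\in K:\ 0\in\nabla f(x)+\bar\partial g(x)+N_K(x)\}.$$ For $\gamma>0$, $w\in\mathbb R^d$ and $h:\mathsf X\to(-\infty,\infty]$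 let $\mathrm{prox}_{\gamma h}(w)$ be the (possibly empty) set of minimizers over $y\in\mathsf X$ of $h(y)+\frac1{2\gamma}\|y-w\|^2$; let $\mathbb I_K$ be $0$ on $K$ and $+\infty$ off $K$, and let $\Pi_K(A)$ be the set of the Euclidean projections onto $K$ of the points of $A$. Let $(\gamma_k)_{k\ge1}$ satisfy $\gamma_k>0$, $\sum_{k\ge1}\gamma_k=\infty$ and $\gamma_k\to0$. Let $x_0\in K$, let $(H_k)_{k\ge1}$ be a sequence in $\mathbb R^d$, let $(x_k)_{k\ge1}$ be generated from $x_0$ by one of the recursions in (i), (ii) below (so that $x_k\in K$ for all $k$), and put $\delta_k=H_k-\nabla f(x_{k-1})$ for $k\ge1$. Suppose that $\sup_{k\ge1}\|\delta_k\|<\infty$ and that $\delta_k=e_k+r_k$ with $\|r_k\|\to0$ and $\sum_{k\ge1}\gamma_ke_k$ convergent. Suppose finally that $(f+g)(\mathcal S)\subseteq\mathbb R$ has empty interior. (i) If $x_k\in\mathrm{prox}_{\gamma_k(g+\mathbb I_K)}(x_{k-1}-\gamma_kH_k)$ for all $k\ge1$, then $x_k$ converges to $\mathcal S$, that is, $\mathcal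 S\neq\emptyset$ and $\lim_{k\to\infty}\mathrm{dist}(x_k,\mathcal S)=0$. (ii) If $g$ is Lipschitz on $\mathsf X$ and $x_k\in\Pi_K(\mathrm{prox}_{\gamma_kg}(x_{k-1}-\gamma_kH_k))$ for all $k\ge1$, then $x_k$ converges to $\mathcal S$ in the same sense. -/

import Mathlib

open Filter Topology Set
open scoped Pointwise

namespace ProxSGD

variable {E : Type*} [NormedAddCommGroup E] [InnerProductSpace ℝ E]

/-- Clarke's generalized directional derivative `f⁰(x; h)`: the limit, as `δ ↓ 0`, of the supremum
of `(f (x + h' + t h) - f (x + h')) / t` over `‖h'‖ ≤ δ` and `0 < t < δ`.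
It only depends on the values of `f` near `x`, and is used where `f` is Lipschitz near `x`,
so that the quotients are bounded and this real upper limit is the genuine one. -/
noncomputable def clarkeDeriv (f : E → ℝ) (x h : E) : ℝ :=
  limsup (fun p : E × ℝ => (f (x + p.1 + p.2 • h) - f (x + p.1)) / p.2)
    (𝓝 (0 : E) ×ˢ 𝓝[>] (0 : ℝ))

/-- Clarke's generalized gradient of `f` at `x`. -/
def clarkeGradient (f : E → ℝ) (x : E) : Set E :=
  {v | ∀ h : E, inner ℝ h v ≤ clarkeDeriv f x h}

/-- `f` is (Clarke) regular at `x`: it is Lipschitz near `x`, and all one-sided directional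
derivatives exist and agree with the generalized directional derivatives. -/
def RegularAt (f : E → ℝ) (x : E) : Prop :=
  (∃ L : NNReal, ∃ t ∈ 𝓝 x, LipschitzOnWith L f t) ∧
  ∀ h : E, Tendsto (fun t : ℝ => (f (x + t • h) - f x) / t) (𝓝[>] 0) (𝓝 (clarkeDeriv f x h))

/-- The normal cone to the convex set `K` at the point `x` of `K`. -/
def normalCone (K : Set E) (x : E) : Set E :=
  {v | ∀ z ∈ K, inner ℝ v (z - x) ≤ 0}

open Classical in
/-- The convex indicator function of `K`: `0` on `K` and `∞` elsewhere. -/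
noncomputable def convexIndicator (K : Set E) (x : E) : EReal :=
  if x ∈ K then 0 else ⊤

/-- The set-valued proximal operator on `X`:
all minimizers over `y ∈ X` of `h y + ‖y - w‖² / (2 γ)`. -/
def prox (X : Set E) (γ : ℝ) (h : E → EReal) (w : E) : Set E :=
  {y | y ∈ X ∧ IsMinOn (fun z => h z + (((2 * γ)⁻¹ * ‖z - w‖ ^ 2 : ℝ) : EReal)) X y}

/-- The set `Π_K(A)` of projections (nearest points in `K`) of the elements of `A`. -/
def projSet (K A : Set E) : Set E :=
  {p | ∃ a ∈ A, p ∈ K ∧ ∀ z ∈ K, ‖a - p‖ ≤ ‖a - z‖}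

/-- The stationary points in `K` of the composite function `f + g`. -/
def stationarySet [CompleteSpace E] (K : Set E) (f g : E → ℝ) : Set E :=
  {x | x ∈ K ∧ (0 : E) ∈ ({gradient f x} : Set E) + clarkeGradient g x + normalCone K x}

/-- The gradient perturbation `δ_k = H_k - ∇ f (x_{k-1})`, meaningful for `k ≥ 1`. -/
noncomputable def gradNoise [CompleteSpace E] (f : E → ℝ) (x H : ℕ → E) (k : ℕ) : E :=
  H k - gradient f (x (k - 1))

/-- The distance from `x k` to `S` tends to `0`. The extended distance to the empty set is `∞`,
so this forces `S` to be nonempty. -/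
def ConvergesToSet (x : ℕ → E) (S : Set E) : Prop :=
  Tendsto (fun k => Metric.infEDist (x k) S) atTop (𝓝 0)

end ProxSGD

/-!
Optimality of the proximal point turns either recursion into
`x k = x (k - 1) - γ k • (H k + ζ k + ν k)`, with `ζ k` a Clarke subgradient of `g` near `x k` and
`ν k` normal to `K` at `x k`. Read as a function of the elapsed time `∑ γ`, the tails of the
sequence have, along every ultrafilter, a Lipschitz limit arc `z`. The noise vanishes in the limit
and the velocity of `z` is a limit of averages of the other directions, so
`-z' ∈ ∇f(z) + ∂g(z) + N_K(z)` almost everywhere.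

Since `g` is regular and `z` stays in `K`, the chain rule gives `((f + g) ∘ z)' = -‖z'‖ ^ 2`. Hence
`f + g` decreases strictly along `z` unless `z` starts in `S`. If the values `(f + g) (x k)` rose
infinitely often from a level `a` outside `(f + g) '' S` to some `b > a`, a limit arc started on the
level `a` would drop below `a` and yet reach `b`. Such levels `a` are dense, so `(f + g) (x k)`
converges, `f + g` is constant on every limit arc, and every limit point of the sequence is in `S`.
-/

namespace ProxSGD

section ClarkeCalculus

variable {E : Type*} [NormedAddCommGroup E] [InnerProductSpace ℝ E] {g : E → ℝ} {x : E}

/-- `g` is Lipschitz on a neighbourhood of `x`. This is the standing assumption under which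
`clarkeDeriv g x` is a genuine upper limit, and the first half of `RegularAt g x`. -/
def LipschitzNear (g : E → ℝ) (x : E) : Prop :=
  ∃ L : NNReal, ∃ t ∈ 𝓝 x, LipschitzOnWith L g t

/-- The difference quotient of `g` near `x` in the direction `h`, with base point `x + p.1` and
step `p.2`; its upper limit is `clarkeDeriv g x h`. -/
noncomputable def clarkeQuotient (g : E → ℝ) (x h : E) (p : E × ℝ) : ℝ :=
  (g (x + p.1 + p.2 • h) - g (x + p.1)) / p.2

omit [InnerProductSpace ℝ E] in
lemma eventually_lipschitzNear (hg : LipschitzNear g x) : ∀ᶠ y in 𝓝 x, LipschitzNear g y := by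
  obtain ⟨L, t, ht, hL⟩ := hg
  filter_upwards [eventually_mem_nhds_iff.2 ht] with y hy using ⟨L, t, hy, hL⟩

lemma tendsto_add_add_smul (x h : E) :
    Tendsto (fun p : E × ℝ => x + p.1 + p.2 • h) (𝓝 (0 : E) ×ˢ 𝓝[>] (0 : ℝ)) (𝓝 x) := by
  have hcont : Continuous (fun p : E × ℝ => x + p.1 + p.2 • h) := by fun_prop
  have hlim := hcont.tendsto (0, 0)
  simp only [add_zero, zero_smul, nhds_prod_eq] at hlim
  exact hlim.mono_left (prod_mono le_rfl nhdsWithin_le_nhds)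

lemma eventually_abs_clarkeQuotient_le {L : NNReal} {t : Set E} (ht : t ∈ 𝓝 x)
    (hL : LipschitzOnWith L g t) (h : E) :
    ∀ᶠ p in 𝓝 (0 : E) ×ˢ 𝓝[>] (0 : ℝ), |clarkeQuotient g x h p| ≤ L * ‖h‖ := by
  filter_upwards [(tendsto_add_add_smul x h).eventually ht,
    (tendsto_add_add_smul x 0).eventually ht,
    tendsto_snd.eventually self_mem_nhdsWithin] with p hend hbase (hpos : 0 < p.2)
  rw [smul_zero, add_zero] at hbase
  have hdist := hL.dist_le_mul _ hend _ hbase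
  rw [Real.dist_eq, dist_eq_norm, add_sub_cancel_left, norm_smul, Real.norm_eq_abs,
    abs_of_pos hpos] at hdist
  rw [clarkeQuotient, abs_div, abs_of_pos hpos, div_le_iff₀ hpos]
  linarith

lemma clarkeDeriv_le_of_eventually {h : E} {c : ℝ} (hg : LipschitzNear g x)
    (hc : ∀ᶠ p in 𝓝 (0 : E) ×ˢ 𝓝[>] (0 : ℝ), clarkeQuotient g x h p ≤ c) :
    clarkeDeriv g x h ≤ c := by
  obtain ⟨L, t, ht, hL⟩ := hg
  refine limsup_le_of_le (IsBoundedUnder.isCoboundedUnder_le ⟨-(L * ‖h‖), ?_⟩) hc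
  rw [eventually_map]
  filter_upwards [eventually_abs_clarkeQuotient_le ht hL h] with p hp using (abs_le.1 hp).1

lemma eventually_clarkeQuotient_lt {h : E} {c : ℝ} (hg : LipschitzNear g x)
    (hc : clarkeDeriv g x h < c) :
    ∀ᶠ p in 𝓝 (0 : E) ×ˢ 𝓝[>] (0 : ℝ), clarkeQuotient g x h p < c := by
  obtain ⟨L, t, ht, hL⟩ := hg
  refine eventually_lt_of_limsup_lt hc ⟨L * ‖h‖, ?_⟩
  rw [eventually_map]
  filter_upwards [eventually_abs_clarkeQuotient_le ht hL h] with p hp using (abs_le.1 hp).2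

lemma clarkeDeriv_le_mul_norm {L : NNReal} {t : Set E} (ht : t ∈ 𝓝 x)
    (hL : LipschitzOnWith L g t) (h : E) : clarkeDeriv g x h ≤ L * ‖h‖ :=
  clarkeDeriv_le_of_eventually ⟨L, t, ht, hL⟩
    ((eventually_abs_clarkeQuotient_le ht hL h).mono fun _ hp => (abs_le.1 hp).2)

lemma norm_le_of_mem_clarkeGradient {v : E} {L : NNReal} {t : Set E} (ht : t ∈ 𝓝 x)
    (hL : LipschitzOnWith L g t) (hv : v ∈ clarkeGradient g x) : ‖v‖ ≤ L := by
  have hsq : ‖v‖ * ‖v‖ ≤ L * ‖v‖ := by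
    rw [← real_inner_self_eq_norm_mul_norm]
    exact (hv v).trans (clarkeDeriv_le_mul_norm ht hL v)
  by_contra! hlt
  exact absurd hsq (mul_lt_mul_of_pos_right hlt (L.coe_nonneg.trans_lt hlt)).not_ge

lemma clarkeQuotient_add (a b : E) (p : E × ℝ) :
    clarkeQuotient g x (a + b) p =
      clarkeQuotient g x a (p.1 + p.2 • b, p.2) + clarkeQuotient g x b p := by
  have hend : x + p.1 + p.2 • (a + b) = x + (p.1 + p.2 • b) + p.2 • a := by
    rw [smul_add]; abel
  simp only [clarkeQuotient, hend, ← add_assoc]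
  ring

lemma clarkeDeriv_add_le (hg : LipschitzNear g x) (a b : E) :
    clarkeDeriv g x (a + b) ≤ clarkeDeriv g x a + clarkeDeriv g x b := by
  refine le_of_forall_pos_le_add fun ε hε => ?_
  have ha := eventually_clarkeQuotient_lt hg
    (lt_add_of_pos_right (clarkeDeriv g x a) (half_pos hε))
  have hb := eventually_clarkeQuotient_lt hg
    (lt_add_of_pos_right (clarkeDeriv g x b) (half_pos hε))
  have hshift : Tendsto (fun p : E × ℝ => (p.1 + p.2 • b, p.2))
      (𝓝 (0 : E) ×ˢ 𝓝[>] (0 : ℝ)) (𝓝 (0 : E) ×ˢ 𝓝[>] (0 : ℝ)) := by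
    simpa only [zero_add] using (tendsto_add_add_smul 0 b).prodMk tendsto_snd
  refine clarkeDeriv_le_of_eventually hg ?_
  filter_upwards [hshift.eventually ha, hb] with p hpa hpb
  rw [clarkeQuotient_add]
  linarith

lemma clarkeDeriv_smul_le (hg : LipschitzNear g x) {c : ℝ} (hc : 0 < c) (h : E) :
    clarkeDeriv g x (c • h) ≤ c * clarkeDeriv g x h := by
  rw [← div_le_iff₀' hc]
  refine le_of_forall_gt_imp_ge_of_dense fun b hb => ?_
  have hscale : Tendsto (fun p : E × ℝ => (p.1, c * p.2))
      (𝓝 (0 : E) ×ˢ 𝓝[>] (0 : ℝ)) (𝓝 (0 : E) ×ˢ 𝓝[>] (0 : ℝ)) := by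
    refine tendsto_id.prodMap (tendsto_nhdsWithin_iff.2 ⟨?_, ?_⟩)
    · simpa only [mul_zero, id] using
        (tendsto_id.const_mul c : Tendsto _ (𝓝 (0 : ℝ)) _).mono_left nhdsWithin_le_nhds
    · filter_upwards [self_mem_nhdsWithin] with t ht using mul_pos hc ht
  rw [div_le_iff₀' hc]
  refine clarkeDeriv_le_of_eventually hg ?_
  filter_upwards [hscale.eventually (eventually_clarkeQuotient_lt hg hb)] with p hp
  have hquot : clarkeQuotient g x (c • h) p = c * clarkeQuotient g x h (p.1, c * p.2) := by
    simp only [clarkeQuotient, smul_smul, mul_comm p.2 c]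
    rw [← mul_div_assoc, mul_div_mul_left _ _ hc.ne']
  rw [hquot]
  gcongr

lemma clarkeDeriv_smul (hg : LipschitzNear g x) {c : ℝ} (hc : 0 < c) (h : E) :
    clarkeDeriv g x (c • h) = c * clarkeDeriv g x h := by
  refine (clarkeDeriv_smul_le hg hc h).antisymm ?_
  have hinv := clarkeDeriv_smul_le hg (inv_pos.2 hc) (c • h)
  rwa [inv_smul_smul₀ hc.ne', ← div_eq_inv_mul, le_div_iff₀' hc] at hinv

lemma upperSemicontinuousAt_clarkeDeriv (hg : LipschitzNear g x) (h : E) :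
    UpperSemicontinuousAt (fun y => clarkeDeriv g y h) x := by
  intro c hc
  obtain ⟨b, hb, hbc⟩ := exists_between hc
  obtain ⟨U, hU, W, hW, hUW⟩ := mem_prod_iff.1 (eventually_clarkeQuotient_lt hg hb)
  have hshift : Tendsto (fun q : E × E => q.1 - x + q.2) (𝓝 x ×ˢ 𝓝 0) (𝓝 0) := by
    have hcont : Continuous (fun q : E × E => q.1 - x + q.2) := by fun_prop
    simpa only [nhds_prod_eq, sub_self, add_zero] using hcont.tendsto (x, (0 : E))
  filter_upwards [(hshift.eventually hU).curry, eventually_lipschitzNear hg] with y hyU hyL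
  refine (clarkeDeriv_le_of_eventually hyL ?_).trans_lt hbc
  filter_upwards [prod_mem_prod hyU hW] with p hp
  have hlt : clarkeQuotient g x h (y - x + p.1, p.2) < b := hUW ⟨hp.1, hp.2⟩
  have hbase : x + (y - x + p.1) = y + p.1 := by abel
  rw [clarkeQuotient, hbase] at hlt
  exact hlt.le

lemma mem_clarkeGradient_of_tendsto {ι : Type*} {F : Filter ι} [F.NeBot] {y ζ : ι → E} {v : E}
    (hg : LipschitzNear g x) (hy : Tendsto y F (𝓝 x)) (hζ : Tendsto ζ F (𝓝 v))
    (hmem : ∀ᶠ i in F, ζ i ∈ clarkeGradient g (y i)) : v ∈ clarkeGradient g x := by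
  intro h
  refine le_of_forall_gt_imp_ge_of_dense fun c hc => ?_
  refine le_of_tendsto (tendsto_const_nhds.inner hζ) ?_
  filter_upwards [hmem, hy.eventually (upperSemicontinuousAt_clarkeDeriv hg h c hc)] with i hi hlt
  exact (hi h).trans hlt.le

/-- By the Lipschitz bound, `g ∘ φ` has the same right derivative at `a` as `g` along the tangent
half-line of `φ`. -/
lemma RegularAt.hasDerivWithinAt_comp {φ : ℝ → E} {w : E} {a : ℝ} (hg : RegularAt g (φ a))
    (hφ : HasDerivWithinAt φ w (Ioi a) a) :
    HasDerivWithinAt (g ∘ φ) (clarkeDeriv g (φ a) w) (Ioi a) a := by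
  obtain ⟨⟨L, t, ht, hL⟩, hdir⟩ := hg
  have hsub : Tendsto (fun s => s - a) (𝓝[>] a) (𝓝[>] 0) := by
    refine tendsto_nhdsWithin_iff.2 ⟨?_, ?_⟩
    · simpa only [sub_self, id] using
        (tendsto_id.sub_const a : Tendsto _ (𝓝 a) _).mono_left nhdsWithin_le_nhds
    · filter_upwards [self_mem_nhdsWithin] with s (hs : a < s) using sub_pos.2 hs
  have hline : Tendsto (fun s => φ a + (s - a) • w) (𝓝[>] a) (𝓝 (φ a)) := by
    simpa only [zero_smul, add_zero] using
      ((tendsto_nhdsWithin_iff.1 hsub).1.smul_const w).const_add (φ a)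
  rw [hasDerivWithinAt_iff_tendsto_slope' self_notMem_Ioi] at hφ ⊢
  have hgap : Tendsto (fun s => L * ‖slope φ a s - w‖) (𝓝[>] a) (𝓝 0) := by
    simpa only [sub_self, norm_zero, mul_zero] using (hφ.sub_const w).norm.const_mul (L : ℝ)
  refine tendsto_of_tendsto_of_dist (hdir w |>.comp hsub) (squeeze_zero' ?_ ?_ hgap)
  · exact .of_forall fun _ => dist_nonneg
  · have hcurve := (hasDerivWithinAt_iff_tendsto_slope' self_notMem_Ioi).2 hφ
    filter_upwards [hcurve.continuousWithinAt.eventually ht, hline.eventually ht,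
      self_mem_nhdsWithin] with s hs hs' (has : a < s)
    have hpos : 0 < s - a := sub_pos.2 has
    have hslope : slope φ a s - w = (s - a)⁻¹ • (φ s - (φ a + (s - a) • w)) := by
      rw [slope_def_module, ← sub_sub, smul_sub _ (φ s - φ a), inv_smul_smul₀ hpos.ne']
    rw [hslope, norm_smul, norm_inv, Real.norm_of_nonneg hpos.le, ← dist_eq_norm, dist_comm,
      Real.dist_eq, slope_def_field]
    simp only [Function.comp_apply]
    rw [← sub_div, sub_sub_sub_cancel_right, abs_div, abs_of_pos hpos, div_eq_inv_mul,
      mul_left_comm]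
    gcongr
    exact hL.dist_le_mul _ hs _ hs'

/-- Regularity makes the forward and the backward right derivatives of `g ∘ z` equal to
`clarkeDeriv g (z t) w` and `clarkeDeriv g (z t) (-w)`, which bound `⟪w, ζ⟫` from both sides. -/
lemma RegularAt.deriv_comp_eq_inner {z : ℝ → E} {w ζ : E} {t D : ℝ} (hg : RegularAt g (z t))
    (hz : HasDerivAt z w t) (hgz : HasDerivAt (g ∘ z) D t) (hζ : ζ ∈ clarkeGradient g (z t)) :
    D = inner ℝ w ζ := by
  have hforward : D = clarkeDeriv g (z t) w :=
    (uniqueDiffWithinAt_Ioi t).eq_deriv _ hgz.hasDerivWithinAt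
      (hg.hasDerivWithinAt_comp hz.hasDerivWithinAt)
  have hbackward : -D = clarkeDeriv g (z t) (-w) := by
    have hz' : HasDerivAt (fun s => z (t - s)) (-w) 0 :=
      HasDerivAt.comp_const_sub t 0 (by rwa [sub_zero])
    have hgz' : HasDerivAt (fun s => (g ∘ z) (t - s)) (-D) 0 :=
      HasDerivAt.comp_const_sub t 0 (by rwa [sub_zero])
    have hg' : RegularAt g (z (t - 0)) := by rwa [sub_zero]
    have hright := hg'.hasDerivWithinAt_comp (φ := fun s => z (t - s)) hz'.hasDerivWithinAt
    rw [sub_zero] at hright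
    exact (uniqueDiffWithinAt_Ioi 0).eq_deriv _ hgz'.hasDerivWithinAt hright
  refine le_antisymm ?_ (hforward ▸ hζ w)
  have hneg := hζ (-w)
  rw [← hbackward, inner_neg_left] at hneg
  exact neg_le_neg_iff.1 hneg

end ClarkeCalculus

section Optimality

/-- Hahn-Banach with a cone constraint: Riesz extension on `E × ℝ` from the vertical axis, applied
to the cone of pairs `(h, r)` with `P (h + c) ≤ r` for some `c` in `T`. -/
lemma exists_linearMap_le_sublinear_nonneg {E : Type*} [AddCommGroup E] [Module ℝ E] {P : E → ℝ}
    (hP_smul : ∀ c : ℝ, 0 < c → ∀ x, P (c • x) = c * P x) (hP_add : ∀ x y, P (x + y) ≤ P x + P y)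
    {T : ConvexCone ℝ E} (hT : T.Pointed) (hPT : ∀ c ∈ T, 0 ≤ P c) :
    ∃ l : E →ₗ[ℝ] ℝ, (∀ h, l h ≤ P h) ∧ ∀ c ∈ T, 0 ≤ l c := by
  have hP_zero : P 0 = 0 := by
    have htwo := hP_smul 2 two_pos 0
    rw [smul_zero] at htwo
    linarith
  let S : ConvexCone ℝ (E × ℝ) :=
    { carrier := {p | ∃ c ∈ T, P (p.1 + c) ≤ p.2}
      smul_mem' := by
        rintro a ha p ⟨c, hc, hp⟩
        refine ⟨a • c, T.smul_mem ha hc, ?_⟩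
        rw [Prod.smul_fst, Prod.smul_snd, ← smul_add, hP_smul a ha, smul_eq_mul]
        gcongr
      add_mem' := by
        rintro p ⟨b, hb, hp⟩ q ⟨c, hc, hq⟩
        refine ⟨b + c, T.add_mem hb hc, ?_⟩
        rw [Prod.fst_add, Prod.snd_add, add_add_add_comm]
        exact (hP_add _ _).trans (add_le_add hp hq) }
  let axis : E × ℝ →ₗ.[ℝ] ℝ := (⟨⊥, 0⟩ : E →ₗ.[ℝ] ℝ).coprod (LinearMap.id.toPMap ⊤)
  obtain ⟨m, hm_axis, hm_S⟩ := riesz_extension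
    (S.toPointedCone
      ⟨0, hT, by simp only [Prod.fst_zero, add_zero, hP_zero, Prod.snd_zero, le_rfl]⟩)
    axis
    (by
      rintro ⟨⟨h, r⟩, hh, _⟩ ⟨c, hc, hr⟩
      obtain rfl : h = 0 := hh
      have hr0 : 0 ≤ r := (hPT c hc).trans (by simpa only [zero_add] using hr)
      simpa [axis] using hr0)
    (fun ⟨h, r⟩ => ⟨⟨(0, P h - r), Submodule.zero_mem _, trivial⟩, 0, hT, by simp⟩)
  have hm_vertical (r : ℝ) : m (0, r) = r := by
    simpa [axis] using hm_axis ⟨(0, r), Submodule.zero_mem _, trivial⟩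
  refine ⟨-(m ∘ₗ LinearMap.inl ℝ E ℝ), fun h => ?_, fun c hc => ?_⟩
  · have hnonneg : 0 ≤ m ((h, 0) + (0, P h)) := hm_S _ ⟨0, hT, by simp⟩
    rw [map_add, hm_vertical] at hnonneg
    exact neg_le_iff_add_nonneg'.2 hnonneg
  · have hnonneg : 0 ≤ m (-(c, 0)) := hm_S _ ⟨c, hc, by simp [hP_zero]⟩
    rwa [map_neg] at hnonneg

variable {E : Type*} [NormedAddCommGroup E] [InnerProductSpace ℝ E]

lemma exists_inner_le_sublinear_nonneg [CompleteSpace E] {P : E → ℝ} {C : ℝ}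
    (hP_smul : ∀ c : ℝ, 0 < c → ∀ x, P (c • x) = c * P x) (hP_add : ∀ x y, P (x + y) ≤ P x + P y)
    (hP_le : ∀ x, P x ≤ C * ‖x‖) {T : ConvexCone ℝ E} (hT : T.Pointed) (hPT : ∀ c ∈ T, 0 ≤ P c) :
    ∃ v : E, (∀ h, inner ℝ h v ≤ P h) ∧ ∀ c ∈ T, 0 ≤ inner ℝ c v := by
  obtain ⟨l, hlP, hlT⟩ := exists_linearMap_le_sublinear_nonneg hP_smul hP_add hT hPT
  have hbound (h : E) : ‖l h‖ ≤ C * ‖h‖ := by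
    refine abs_le'.2 ⟨(hlP h).trans (hP_le h), ?_⟩
    rw [← map_neg, ← norm_neg h]
    exact (hlP (-h)).trans (hP_le (-h))
  have hriesz (h : E) :
      inner ℝ h ((InnerProductSpace.toDual ℝ E).symm (l.mkContinuous C hbound)) = l h := by
    rw [real_inner_comm, InnerProductSpace.toDual_symm_apply, LinearMap.mkContinuous_apply]
  exact ⟨_, fun h => (hriesz h).trans_le (hlP h), fun c hc => (hlT c hc).trans_eq (hriesz c).symm⟩

variable {g φ : E → ℝ} {K : Set E} {y q : E}

lemma RegularAt.clarkeDeriv_add_inner_nonneg [CompleteSpace E] {p : E} (hg : RegularAt g y)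
    (hφ : HasGradientAt φ q y)
    (hmin : ∀ᶠ t : ℝ in 𝓝[>] 0, g y + φ y ≤ g (y + t • p) + φ (y + t • p)) :
    0 ≤ clarkeDeriv g y p + inner ℝ q p := by
  have hline : HasDerivAt (fun t : ℝ => y + t • p) p 0 := by
    simpa only [one_smul, id] using ((hasDerivAt_id (0 : ℝ)).smul_const p).const_add y
  have hy : y + (0 : ℝ) • p = y := by rw [zero_smul, add_zero]
  have hgline := RegularAt.hasDerivWithinAt_comp (g := g) (by rwa [hy]) hline.hasDerivWithinAt
  have hφline := (show HasFDerivAt φ _ (y + (0 : ℝ) • p) by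
    rw [hy]; exact hφ.hasFDerivAt).comp_hasDerivAt 0 hline
  have hslope := (hasDerivWithinAt_iff_tendsto_slope' self_notMem_Ioi).1
    (hgline.add hφline.hasDerivWithinAt)
  rw [hy, InnerProductSpace.toDual_apply_apply] at hslope
  refine ge_of_tendsto hslope ?_
  filter_upwards [hmin, self_mem_nhdsWithin] with t ht (ht0 : 0 < t)
  rw [slope_def_field]
  refine div_nonneg (sub_nonneg.2 ?_) (sub_nonneg.2 ht0.le)
  simpa only [Pi.add_apply, Function.comp_apply, hy] using ht

lemma RegularAt.neg_mem_clarkeGradient_of_isLocalMin [CompleteSpace E] (hg : RegularAt g y)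
    (hφ : HasGradientAt φ q y) (hmin : IsLocalMin (fun z => g z + φ z) y) :
    -q ∈ clarkeGradient g y := by
  intro h
  have hline : Tendsto (fun t : ℝ => y + t • h) (𝓝[>] 0) (𝓝 y) := by
    have hcont : Continuous (fun t : ℝ => y + t • h) := by fun_prop
    simpa only [zero_smul, add_zero] using (hcont.tendsto 0).mono_left nhdsWithin_le_nhds
  have hnonneg := hg.clarkeDeriv_add_inner_nonneg hφ (hline.eventually hmin)
  rw [inner_neg_right, real_inner_comm]
  linarith

lemma RegularAt.exists_mem_clarkeGradient_of_isMinOn [CompleteSpace E] (hg : RegularAt g y)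
    (hφ : HasGradientAt φ q y) (hK : Convex ℝ K) (hy : y ∈ K)
    (hmin : IsMinOn (fun z => g z + φ z) K y) :
    ∃ ζ ∈ clarkeGradient g y, -(q + ζ) ∈ normalCone K y := by
  have hdir : ∀ z ∈ K, 0 ≤ clarkeDeriv g y (z - y) + inner ℝ q (z - y) := by
    intro z hz
    refine hg.clarkeDeriv_add_inner_nonneg hφ ?_
    filter_upwards [Ioc_mem_nhdsGT (zero_lt_one (α := ℝ))] with t ht
    exact hmin (hK.add_smul_sub_mem hy hz ⟨ht.1.le, ht.2⟩)
  have hP_smul (c : ℝ) (hc : 0 < c) (h : E) : clarkeDeriv g y (c • h) + inner ℝ q (c • h) =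
      c * (clarkeDeriv g y h + inner ℝ q h) := by
    rw [clarkeDeriv_smul hg.1 hc, inner_smul_right, mul_add]
  have hP_add (a b : E) : clarkeDeriv g y (a + b) + inner ℝ q (a + b) ≤
      clarkeDeriv g y a + inner ℝ q a + (clarkeDeriv g y b + inner ℝ q b) := by
    rw [inner_add_right, add_add_add_comm]
    gcongr
    exact clarkeDeriv_add_le hg.1 a b
  obtain ⟨L, t, ht, hL⟩ := hg.1
  have hP_le (h : E) : clarkeDeriv g y h + inner ℝ q h ≤ (L + ‖q‖) * ‖h‖ := by
    rw [add_mul]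
    exact add_le_add (clarkeDeriv_le_mul_norm ht hL h) (real_inner_le_norm q h)
  have hcone : Convex ℝ ((fun z => z - y) '' K) := by
    simpa only [sub_eq_neg_add] using hK.translate (-y)
  obtain ⟨v, hvP, hvT⟩ := exists_inner_le_sublinear_nonneg hP_smul hP_add hP_le
    (T := ConvexCone.hull ℝ ((fun z => z - y) '' K))
    (ConvexCone.subset_hull ⟨y, hy, sub_self y⟩)
    (by
      intro c hc
      obtain ⟨r, hr, _, ⟨z, hz, rfl⟩, rfl⟩ := (ConvexCone.mem_hull_of_convex hcone).1 hc
      exact (mul_nonneg hr.le (hdir z hz)).trans_eq (hP_smul r hr _).symm)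
  refine ⟨v - q, fun h => ?_, fun z hz => ?_⟩
  · rw [inner_sub_right, sub_le_iff_le_add, real_inner_comm q h]
    exact hvP h
  · rw [add_sub_cancel, inner_neg_left, neg_nonpos, real_inner_comm]
    exact hvT _ (ConvexCone.subset_hull ⟨z, hz, rfl⟩)

lemma hasGradientAt_inv_two_mul_norm_sub_sq [CompleteSpace E] (γ : ℝ) (w y : E) :
    HasGradientAt (fun z => (2 * γ)⁻¹ * ‖z - w‖ ^ 2) (γ⁻¹ • (y - w)) y := by
  have hderiv := (((hasFDerivAt_id y).sub_const w).norm_sq).const_mul (2 * γ)⁻¹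
  refine hderiv.congr_fderiv ?_
  ext h
  simp
  ring

omit [InnerProductSpace ℝ E] in
lemma mem_and_isMinOn_of_mem_prox_coe {X : Set E} {γ : ℝ} {w : E}
    (hy : y ∈ prox X γ (fun z => (g z : EReal)) w) :
    y ∈ X ∧ IsMinOn (fun z => g z + (2 * γ)⁻¹ * ‖z - w‖ ^ 2) X y := by
  refine ⟨hy.1, fun z hz => ?_⟩
  exact EReal.coe_le_coe_iff.1 (by simpa only [EReal.coe_add, mem_ofPred_eq] using hy.2 hz)

omit [InnerProductSpace ℝ E] in
lemma mem_and_isMinOn_of_mem_prox_add_convexIndicator {X : Set E} (hKX : K ⊆ X)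
    (hK : K.Nonempty) {γ : ℝ} {w : E}
    (hy : y ∈ prox X γ (fun z => (g z : EReal) + convexIndicator K z) w) :
    y ∈ K ∧ IsMinOn (fun z => g z + (2 * γ)⁻¹ * ‖z - w‖ ^ 2) K y := by
  have hle : ∀ z ∈ K, (g y : EReal) + convexIndicator K y +
      (((2 * γ)⁻¹ * ‖y - w‖ ^ 2 : ℝ) : EReal) ≤
      ((g z + (2 * γ)⁻¹ * ‖z - w‖ ^ 2 : ℝ) : EReal) := by
    intro z hz
    simpa only [convexIndicator, hz, if_true, add_zero, EReal.coe_add, mem_ofPred_eq] using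
      hy.2 (hKX hz)
  have hyK : y ∈ K := by
    by_contra hyK
    obtain ⟨z, hz⟩ := hK
    have htop := hle z hz
    rw [convexIndicator, if_neg hyK, EReal.coe_add_top, EReal.top_add_coe] at htop
    exact EReal.coe_ne_top _ (top_le_iff.1 htop)
  refine ⟨hyK, fun z hz => EReal.coe_le_coe_iff.1 ?_⟩
  simpa only [convexIndicator, hyK, if_true, add_zero, EReal.coe_add] using hle z hz

lemma sub_mem_normalCone_iff (hK : Convex ℝ K) {a p : E} (hp : p ∈ K) :
    a - p ∈ normalCone K p ↔ ∀ z ∈ K, ‖a - p‖ ≤ ‖a - z‖ := by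
  have hbdd : BddBelow (range fun z : K => ‖a - z‖) :=
    ⟨0, forall_mem_range.2 fun _ => norm_nonneg _⟩
  have : Nonempty K := ⟨⟨p, hp⟩⟩
  rw [normalCone, mem_ofPred_eq, ← norm_eq_iInf_iff_real_inner_le_zero hK hp]
  refine ⟨fun heq z hz => heq.trans_le (ciInf_le hbdd ⟨z, hz⟩), fun hnear => ?_⟩
  exact (le_ciInf fun z : K => hnear z z.2).antisymm (ciInf_le hbdd ⟨p, hp⟩)

lemma smul_mem_normalCone {v : E} {c : ℝ} (hc : 0 ≤ c) (hv : v ∈ normalCone K y) :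
    c • v ∈ normalCone K y := fun z hz => by
  rw [real_inner_smul_left]
  exact mul_nonpos_of_nonneg_of_nonpos hc (hv z hz)

lemma exists_norm_clarkeGradient_le (hK : IsCompact K) (hg : ∀ y ∈ K, LipschitzNear g y) :
    ∃ L : ℝ, ∀ y ∈ K, ∀ ζ ∈ clarkeGradient g y, ‖ζ‖ ≤ L := by
  refine hK.induction_on (p := fun s => ∃ L : ℝ, ∀ y ∈ s, ∀ ζ ∈ clarkeGradient g y, ‖ζ‖ ≤ L)
    ⟨0, fun _ h => h.elim⟩ ?_ ?_ ?_
  · rintro s t hst ⟨L, hL⟩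
    exact ⟨L, fun y hy => hL y (hst hy)⟩
  · rintro s t ⟨L, hL⟩ ⟨M, hM⟩
    exact ⟨max L M, fun y hy ζ hζ => hy.elim
      (fun hs => (hL y hs ζ hζ).trans (le_max_left L M))
      (fun ht => (hM y ht ζ hζ).trans (le_max_right L M))⟩
  · intro y hy
    obtain ⟨L, t, ht, hL⟩ := hg y hy
    refine ⟨interior t, mem_nhdsWithin_of_mem_nhds (interior_mem_nhds.2 ht), L, fun z hz ζ hζ => ?_⟩
    exact norm_le_of_mem_clarkeGradient (mem_interior_iff_mem_nhds.1 hz) hL hζ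

end Optimality

section InclusionStep

variable {E : Type*} [NormedAddCommGroup E] [InnerProductSpace ℝ E] {g : E → ℝ} {K : Set E}
  {x x' y H ζ : E} {γ L M : ℝ}

/-- `x'` arises from `x` by a step of size `γ` along `-(H + ζ + ν)`, where `ν` is normal to `K` at
`x'` and `ζ` is a Clarke subgradient of `g` at a point within `C * γ` of `x'`. All three directions
are bounded by `C`. -/
def IsInclusionStep (K : Set E) (g : E → ℝ) (C γ : ℝ) (x H x' : E) : Prop :=
  x' ∈ K ∧ ‖H‖ ≤ C ∧ ∃ y ζ ν : E, x' = x - γ • (H + ζ + ν) ∧ ζ ∈ clarkeGradient g y ∧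
    ν ∈ normalCone K x' ∧ ‖ζ‖ ≤ C ∧ ‖ν‖ ≤ C ∧ ‖y - x'‖ ≤ C * γ

/-- The normal part `ν = γ⁻¹ • (v - x')` is bounded because `x'` is the point of `K` nearest to
`v = x - γ • (H + ζ)`, so that `‖v - x'‖ ≤ ‖v - x‖`. -/
lemma isInclusionStep_of_sub_mem_normalCone (hK : Convex ℝ K) (hγ : 0 < γ) (hx : x ∈ K)
    (hx' : x' ∈ K) (hH : ‖H‖ ≤ M) (hζ : ζ ∈ clarkeGradient g y) (hζL : ‖ζ‖ ≤ L)
    (hν : x - γ • (H + ζ) - x' ∈ normalCone K x') (hy : ‖y - x'‖ ≤ (M + L) * γ) :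
    IsInclusionStep K g (M + L) γ x H x' := by
  refine ⟨hx', hH.trans (le_add_of_nonneg_right ((norm_nonneg ζ).trans hζL)), y, ζ,
    γ⁻¹ • (x - γ • (H + ζ) - x'), ?_, hζ, smul_mem_normalCone (inv_nonneg.2 hγ.le) hν,
    hζL.trans (le_add_of_nonneg_left ((norm_nonneg H).trans hH)), ?_, hy⟩
  · rw [smul_add, smul_inv_smul₀ hγ.ne', ← sub_sub, sub_sub_cancel]
  · have hnear := (sub_mem_normalCone_iff hK hx').1 hν x hx
    rw [sub_sub_cancel_left, norm_neg, norm_smul, Real.norm_of_nonneg hγ.le] at hnear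
    rw [norm_smul, norm_inv, Real.norm_of_nonneg hγ.le, inv_mul_le_iff₀ hγ]
    exact hnear.trans (by gcongr; exact (norm_add_le H ζ).trans (add_le_add hH hζL))

lemma isInclusionStep_of_mem_prox_add_convexIndicator [CompleteSpace E] {X : Set E} (hKX : K ⊆ X)
    (hK : Convex ℝ K) (hg : ∀ y ∈ K, RegularAt g y)
    (hL : ∀ y ∈ K, ∀ ζ ∈ clarkeGradient g y, ‖ζ‖ ≤ L) (hγ : 0 < γ) (hx : x ∈ K) (hH : ‖H‖ ≤ M)
    (hx' : x' ∈ prox X γ (fun z => (g z : EReal) + convexIndicator K z) (x - γ • H)) :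
    IsInclusionStep K g (M + L) γ x H x' := by
  obtain ⟨hx'K, hmin⟩ := mem_and_isMinOn_of_mem_prox_add_convexIndicator hKX ⟨x, hx⟩ hx'
  obtain ⟨ζ, hζ, hν⟩ := (hg x' hx'K).exists_mem_clarkeGradient_of_isMinOn
    (hasGradientAt_inv_two_mul_norm_sub_sq γ _ x') hK hx'K hmin
  have hζL := hL x' hx'K ζ hζ
  refine isInclusionStep_of_sub_mem_normalCone hK hγ hx hx'K hH hζ hζL ?_ ?_
  · have hscale : x - γ • (H + ζ) - x' = γ • -(γ⁻¹ • (x' - (x - γ • H)) + ζ) := by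
      rw [smul_neg, smul_add, smul_add, smul_inv_smul₀ hγ.ne']
      abel
    rw [hscale]
    exact smul_mem_normalCone hγ.le hν
  · rw [sub_self, norm_zero]
    exact mul_nonneg (add_nonneg ((norm_nonneg H).trans hH) ((norm_nonneg ζ).trans hζL)) hγ.le

lemma isInclusionStep_of_mem_projSet_prox [CompleteSpace E] {X : Set E} {L : NNReal}
    (hX : IsOpen X) (hK : Convex ℝ K) (hg : ∀ y ∈ X, RegularAt g y) (hL : LipschitzOnWith L g X)
    (hγ : 0 < γ) (hx : x ∈ K) (hH : ‖H‖ ≤ M)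
    (hx' : x' ∈ projSet K (prox X γ (fun z => (g z : EReal)) (x - γ • H))) :
    IsInclusionStep K g (M + L) γ x H x' := by
  obtain ⟨y, hy, hx'K, hnear⟩ := hx'
  obtain ⟨hyX, hmin⟩ := mem_and_isMinOn_of_mem_prox_coe hy
  have hζ := (hg y hyX).neg_mem_clarkeGradient_of_isLocalMin
    (hasGradientAt_inv_two_mul_norm_sub_sq γ _ y) (hmin.isLocalMin (hX.mem_nhds hyX))
  have hζL := norm_le_of_mem_clarkeGradient (hX.mem_nhds hyX) hL hζ
  set ζ := -(γ⁻¹ • (y - (x - γ • H)))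
  have hyx : x - γ • (H + ζ) = y := by
    rw [smul_add, smul_neg, smul_inv_smul₀ hγ.ne']
    abel
  refine isInclusionStep_of_sub_mem_normalCone hK hγ hx hx'K hH hζ hζL ?_ ?_
  · rw [hyx]
    exact (sub_mem_normalCone_iff hK hx'K).2 hnear
  · refine (hnear x hx).trans ?_
    rw [← hyx, sub_sub_cancel_left, norm_neg, norm_smul, Real.norm_of_nonneg hγ.le, mul_comm]
    gcongr
    exact (norm_add_le H ζ).trans (add_le_add hH hζL)

end InclusionStep

section Clock

variable {γ : ℕ → ℝ} {n k : ℕ} {s t : ℝ}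

/-- The time elapsed after `k` steps of sizes `γ 1, …, γ k`. -/
noncomputable def clock (γ : ℕ → ℝ) (k : ℕ) : ℝ := ∑ i ∈ Finset.Icc 1 k, γ i

/-- The first index `k ≥ n` at which the time `t` has elapsed since step `n`. Reading a sequence at
the indices `hit γ n t` turns it into a function of the time `t`, started at step `n`. -/
noncomputable def hit (γ : ℕ → ℝ) (n : ℕ) (t : ℝ) : ℕ :=
  sInf {k | n ≤ k ∧ clock γ n + t ≤ clock γ k}

/-- Step sizes of a stochastic approximation: nonnegative, vanishing, with divergent sum. The
value `γ 0` is never used, since the first step has size `γ 1`. -/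
structure IsStepSize (γ : ℕ → ℝ) : Prop where
  nonneg : ∀ k, 1 ≤ k → 0 ≤ γ k
  tendsto_clock : Tendsto (clock γ) atTop atTop
  tendsto_zero : Tendsto γ atTop (𝓝 0)

lemma clock_succ (γ : ℕ → ℝ) (k : ℕ) : clock γ (k + 1) = clock γ k + γ (k + 1) :=
  Finset.sum_Icc_succ_top (Nat.le_add_left 1 k) _

lemma clock_sub_clock (γ : ℕ → ℝ) {a b : ℕ} (hab : a ≤ b) :
    clock γ b - clock γ a = ∑ i ∈ Finset.Ioc a b, γ i := by
  induction b, hab using Nat.le_induction with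
  | base => simp only [sub_self, Finset.Ioc_self, Finset.sum_empty]
  | succ b hab ih =>
    rw [clock_succ, add_sub_right_comm, ih, Finset.sum_Ioc_succ_top (by lia)]

lemma IsStepSize.clock_mono (hγ : IsStepSize γ) : Monotone (clock γ) :=
  monotone_nat_of_le_succ fun k => by
    rw [clock_succ]
    exact le_add_of_nonneg_right (hγ.nonneg (k + 1) (Nat.le_add_left 1 k))

lemma IsStepSize.hit_spec (hγ : IsStepSize γ) (n : ℕ) (t : ℝ) :
    n ≤ hit γ n t ∧ clock γ n + t ≤ clock γ (hit γ n t) :=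
  Nat.sInf_mem ((eventually_ge_atTop n).and
    (hγ.tendsto_clock.eventually_ge_atTop (clock γ n + t))).exists

lemma hit_le (hk : n ≤ k) (h : clock γ n + t ≤ clock γ k) : hit γ n t ≤ k :=
  Nat.sInf_le ⟨hk, h⟩

lemma clock_lt_of_lt_hit (hk : n ≤ k) (h : k < hit γ n t) : clock γ k < clock γ n + t :=
  lt_of_not_ge fun hle => h.not_ge (hit_le hk hle)

lemma IsStepSize.hit_mono (hγ : IsStepSize γ) (n : ℕ) : Monotone (hit γ n) := fun _ t hst =>
  hit_le (hγ.hit_spec n t).1 ((add_le_add_right hst _).trans (hγ.hit_spec n t).2)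

lemma IsStepSize.hit_zero (hγ : IsStepSize γ) (n : ℕ) : hit γ n 0 = n :=
  (hit_le le_rfl (add_zero _).le).antisymm (hγ.hit_spec n 0).1

lemma IsStepSize.tendsto_hit (hγ : IsStepSize γ) (t : ℝ) :
    Tendsto (fun n => hit γ n t) atTop atTop :=
  tendsto_atTop_mono (fun n => (hγ.hit_spec n t).1) tendsto_id

lemma IsStepSize.clock_hit_le (hγ : IsStepSize γ) (n : ℕ) (t : ℝ) :
    clock γ (hit γ n t) ≤ clock γ n + max t 0 + |γ (hit γ n t)| := by
  rcases (hγ.hit_spec n t).1.eq_or_lt with heq | hlt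
  · rw [← heq]
    linarith [le_max_right t 0, abs_nonneg (γ n)]
  · obtain ⟨m, hm⟩ := Nat.exists_eq_add_one_of_ne_zero (Nat.ne_zero_of_lt hlt)
    have hbefore := clock_lt_of_lt_hit (γ := γ) (t := t) (k := m) (n := n) (by lia) (by lia)
    rw [hm, clock_succ]
    linarith [le_max_left t 0, le_abs_self (γ (m + 1))]

lemma IsStepSize.tendsto_clock_hit_sub (hγ : IsStepSize γ) (t : ℝ) :
    Tendsto (fun n => clock γ (hit γ n t) - clock γ n) atTop (𝓝 (max t 0)) := by
  have hupper : Tendsto (fun n => max t 0 + |γ (hit γ n t)|) atTop (𝓝 (max t 0)) := by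
    simpa only [Function.comp_def, abs_zero, add_zero] using
      (hγ.tendsto_zero.comp (hγ.tendsto_hit t)).abs.const_add (max t 0)
  refine tendsto_of_tendsto_of_tendsto_of_le_of_le tendsto_const_nhds hupper
    (fun n => max_le ?_ ?_) fun n => ?_
  · exact le_sub_iff_add_le'.2 (hγ.hit_spec n t).2
  · exact sub_nonneg.2 (hγ.clock_mono (hγ.hit_spec n t).1)
  · rw [sub_le_iff_le_add', ← add_assoc]
    exact hγ.clock_hit_le n t

lemma IsStepSize.tendsto_clock_hit_sub_clock_hit (hγ : IsStepSize γ) (s t : ℝ) :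
    Tendsto (fun n => clock γ (hit γ n t) - clock γ (hit γ n s)) atTop
      (𝓝 (max t 0 - max s 0)) := by
  simpa only [sub_sub_sub_cancel_right] using
    (hγ.tendsto_clock_hit_sub t).sub (hγ.tendsto_clock_hit_sub s)

end Clock

section WeightedSum

variable {E : Type*} [AddCommGroup E] [Module ℝ E] {γ : ℕ → ℝ}

/-- The partial sum of `u 1, …, u k` with weights `γ 1, …, γ k`: the displacement after `k` steps
of sizes `γ i` along the directions `u i`. -/
noncomputable def weightedSum (γ : ℕ → ℝ) (u : ℕ → E) (k : ℕ) : E :=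
  ∑ i ∈ Finset.Icc 1 k, γ i • u i

lemma weightedSum_succ (γ : ℕ → ℝ) (u : ℕ → E) (k : ℕ) :
    weightedSum γ u (k + 1) = weightedSum γ u k + γ (k + 1) • u (k + 1) :=
  Finset.sum_Icc_succ_top (Nat.le_add_left 1 k) _

lemma weightedSum_add (γ : ℕ → ℝ) (u v : ℕ → E) (k : ℕ) :
    weightedSum γ (u + v) k = weightedSum γ u k + weightedSum γ v k := by
  simp only [weightedSum, Pi.add_apply, smul_add, Finset.sum_add_distrib]

lemma weightedSum_congr {u v : ℕ → E} (h : ∀ k, 1 ≤ k → u k = v k) (k : ℕ) :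
    weightedSum γ u k = weightedSum γ v k :=
  Finset.sum_congr rfl fun i hi => by rw [h i (Finset.mem_Icc.1 hi).1]

lemma weightedSum_sub_weightedSum (γ : ℕ → ℝ) (u : ℕ → E) {a b : ℕ} (hab : a ≤ b) :
    weightedSum γ u b - weightedSum γ u a = ∑ i ∈ Finset.Ioc a b, γ i • u i := by
  induction b, hab using Nat.le_induction with
  | base => simp only [sub_self, Finset.Ioc_self, Finset.sum_empty]
  | succ b hab ih =>
    rw [weightedSum_succ, add_sub_right_comm, ih, Finset.sum_Ioc_succ_top (by lia)]

lemma eq_sub_weightedSum {x u : ℕ → E}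
    (h : ∀ k, 1 ≤ k → x k = x (k - 1) - γ k • u k) (k : ℕ) : x k = x 0 - weightedSum γ u k := by
  induction k with
  | zero => simp [weightedSum]
  | succ k ih =>
    rw [h (k + 1) (Nat.le_add_left 1 k), Nat.add_sub_cancel, ih, weightedSum_succ, sub_sub]

lemma IsStepSize.map_weightedSum_sub_le (hγ : IsStepSize γ) {u : ℕ → E} {φ : E →ₗ[ℝ] ℝ} {c : ℝ}
    {a b : ℕ} (hab : a ≤ b) (h : ∀ i, a < i → i ≤ b → φ (u i) ≤ c) :
    φ (weightedSum γ u b - weightedSum γ u a) ≤ c * (clock γ b - clock γ a) := by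
  rw [weightedSum_sub_weightedSum γ u hab, clock_sub_clock γ hab, Finset.mul_sum, map_sum]
  refine Finset.sum_le_sum fun i hi => ?_
  obtain ⟨hai, hib⟩ := Finset.mem_Ioc.1 hi
  rw [map_smul, smul_eq_mul, mul_comm]
  exact mul_le_mul_of_nonneg_right (h i hai hib) (hγ.nonneg i (by lia))

lemma IsStepSize.norm_weightedSum_sub_le {F : Type*} [NormedAddCommGroup F] [NormedSpace ℝ F]
    (hγ : IsStepSize γ) {u : ℕ → F} {c : ℝ} {a b : ℕ} (hab : a ≤ b)
    (h : ∀ i, a < i → i ≤ b → ‖u i‖ ≤ c) :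
    ‖weightedSum γ u b - weightedSum γ u a‖ ≤ c * (clock γ b - clock γ a) := by
  rw [weightedSum_sub_weightedSum γ u hab, clock_sub_clock γ hab, Finset.mul_sum]
  refine norm_sum_le_of_le _ fun i hi => ?_
  obtain ⟨hai, hib⟩ := Finset.mem_Ioc.1 hi
  have hγi := hγ.nonneg i (by lia)
  rw [norm_smul, Real.norm_of_nonneg hγi, mul_comm]
  exact mul_le_mul_of_nonneg_right (h i hai hib) hγi

end WeightedSum

section LimitArc

variable {α : Type*} [PseudoMetricSpace α] {γ : ℕ → ℝ} {C : NNReal} {l : Filter ℕ} {x : ℕ → α}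
  {z : ℝ → α} {s t : ℝ}

/-- A sequence that is `C`-Lipschitz with respect to the time `clock γ`. -/
def IsClockLipschitz (C : NNReal) (γ : ℕ → ℝ) (x : ℕ → α) : Prop :=
  ∀ a b, dist (x a) (x b) ≤ C * dist (clock γ a) (clock γ b)

/-- The arc `z` describes, along the filter `l` of starting indices `n`, the limit of the sequence
`x` read from step `n` on as a function of the elapsed time. -/
def IsLimitArc (γ : ℕ → ℝ) (l : Filter ℕ) (x : ℕ → α) (z : ℝ → α) : Prop :=
  ∀ t, Tendsto (fun n => x (hit γ n t)) l (𝓝 (z t))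

lemma IsStepSize.tendsto_dist_clock_hit (hγ : IsStepSize γ) (hl : l ≤ atTop) (s t : ℝ) :
    Tendsto (fun n => dist (clock γ (hit γ n t)) (clock γ (hit γ n s))) l
      (𝓝 |max t 0 - max s 0|) :=
  ((hγ.tendsto_clock_hit_sub_clock_hit s t).mono_left hl).abs

lemma IsClockLipschitz.le_mul_dist_of_tendsto [l.NeBot] (hx : IsClockLipschitz C γ x)
    (hγ : IsStepSize γ) (hl : l ≤ atTop) {r : ℝ}
    (h : Tendsto (fun n => dist (x (hit γ n t)) (x (hit γ n s))) l (𝓝 r)) : r ≤ C * dist t s :=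
  (le_of_tendsto_of_tendsto' h ((hγ.tendsto_dist_clock_hit hl s t).const_mul (C : ℝ))
    fun _ => hx _ _).trans
    (mul_le_mul_of_nonneg_left (abs_max_sub_max_le_abs t s 0) C.coe_nonneg)

lemma IsLimitArc.tendsto_start (hz : IsLimitArc γ l x z) (hγ : IsStepSize γ) :
    Tendsto x l (𝓝 (z 0)) := by
  simpa only [hγ.hit_zero] using hz 0

lemma IsLimitArc.lipschitzWith [l.NeBot] (hz : IsLimitArc γ l x z) (hx : IsClockLipschitz C γ x)
    (hγ : IsStepSize γ) (hl : l ≤ atTop) : LipschitzWith C z :=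
  LipschitzWith.of_dist_le_mul fun t s => hx.le_mul_dist_of_tendsto hγ hl ((hz t).dist (hz s))

lemma exists_isLimitArc_of_isCompact {K : Set α} (hK : IsCompact K) (hx : ∀ k, x k ∈ K)
    (U : Ultrafilter ℕ) : ∃ z, (∀ t, z t ∈ K) ∧ IsLimitArc γ U x z := by
  have hlim : ∀ t, ∃ a ∈ K, Tendsto (fun n => x (hit γ n t)) U (𝓝 a) := fun t =>
    hK.ultrafilter_le_nhds (U.map fun n => x (hit γ n t))
      (le_principal_iff.2 (Eventually.of_forall (f := (U : Filter ℕ)) fun _ => hx _))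
  choose z hzK hz using hlim
  exact ⟨z, hzK, hz⟩

lemma IsLimitArc.tendsto_of_tendsto_clock_sub (hz : IsLimitArc γ l x z)
    (hx : IsClockLipschitz C γ x) (hγ : IsStepSize γ) (hl : l ≤ atTop) (ht : 0 ≤ t) {m : ℕ → ℕ}
    (hm : Tendsto (fun n => clock γ (m n) - clock γ n) l (𝓝 t)) :
    Tendsto (fun n => x (m n)) l (𝓝 (z t)) := by
  have hclock : Tendsto (fun n => (C : ℝ) * dist (clock γ (hit γ n t)) (clock γ (m n))) l
      (𝓝 0) := by
    have hdiff := (((hγ.tendsto_clock_hit_sub t).mono_left hl).sub hm).abs.const_mul (C : ℝ)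
    simpa only [sub_sub_sub_cancel_right, max_eq_left ht, sub_self, abs_zero, mul_zero,
      Real.dist_eq] using hdiff
  exact (hz t).congr_dist (squeeze_zero (fun _ => dist_nonneg) (fun _ => hx _ _) hclock)

lemma IsLimitArc.eventually_forall_le_hit (hz : IsLimitArc γ l x z) (hx : IsClockLipschitz C γ x)
    (hγ : IsStepSize γ) (hl : l ≤ atTop) (ht : 0 ≤ t) {P : ℕ → Prop}
    (hP : ∀ᶠ i in atTop ⊓ comap x (𝓝 (z t)), P i) :
    ∃ ρ > 0, ∀ᶠ n in l, ∀ i, hit γ n t ≤ i → i ≤ hit γ n (t + ρ) → P i := by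
  obtain ⟨⟨N, ε⟩, ⟨-, hε⟩, hPε⟩ :=
    (atTop_basis.inf (Metric.nhds_basis_ball.comap x)).eventually_iff.1 hP
  obtain ⟨ρ, hρ, hCρ⟩ : ∃ ρ > 0, C * ρ < ε / 2 := by
    obtain ⟨ρ, hρ, h⟩ := exists_pos_mul_lt (half_pos hε) (C : ℝ)
    exact ⟨ρ, hρ, h⟩
  have hspan : Tendsto (fun n => (C : ℝ) * (clock γ (hit γ n (t + ρ)) - clock γ (hit γ n t))) l
      (𝓝 (C * ρ)) := by
    have h := ((hγ.tendsto_clock_hit_sub_clock_hit t (t + ρ)).mono_left hl).const_mul (C : ℝ)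
    rwa [max_eq_left ht, max_eq_left (add_nonneg ht hρ.le), add_sub_cancel_left] at h
  refine ⟨ρ, hρ, ?_⟩
  filter_upwards [hl (eventually_ge_atTop N), hspan.eventually_lt_const hCρ,
    (hz t).eventually (Metric.ball_mem_nhds _ (half_pos hε))] with n hnN hspan_n hball i hti hiρ
  refine hPε ⟨hnN.trans ((hγ.hit_spec n t).1.trans hti), ?_⟩
  calc dist (x i) (z t) ≤ dist (x i) (x (hit γ n t)) + dist (x (hit γ n t)) (z t) :=
        dist_triangle _ _ _
    _ < ε / 2 + ε / 2 := by
      refine add_lt_add (lt_of_le_of_lt ?_ hspan_n) hball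
      refine (hx _ _).trans (mul_le_mul_of_nonneg_left ?_ C.coe_nonneg)
      rw [Real.dist_eq, abs_of_nonneg (sub_nonneg.2 (hγ.clock_mono hti))]
      exact sub_le_sub_right (hγ.clock_mono hiρ) _
    _ = ε := add_halves ε

lemma IsClockLipschitz.tendsto_dist_pred (hx : IsClockLipschitz C γ x) (hγ : IsStepSize γ) :
    Tendsto (fun k => dist (x k) (x (k - 1))) atTop (𝓝 0) := by
  have hstep : Tendsto (fun k => C * |γ k|) atTop (𝓝 0) := by
    simpa only [abs_zero, mul_zero] using hγ.tendsto_zero.abs.const_mul (C : ℝ)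
  refine squeeze_zero' (Eventually.of_forall fun _ => dist_nonneg) ?_ hstep
  filter_upwards [eventually_ge_atTop 1] with k hk
  obtain ⟨k, rfl⟩ := Nat.exists_eq_add_of_le' hk
  refine (hx _ _).trans_eq ?_
  rw [Nat.add_sub_cancel, Real.dist_eq, clock_succ, add_sub_cancel_left]

end LimitArc

section IncrementLimit

variable {E : Type*} [NormedAddCommGroup E] {γ : ℕ → ℝ} {C : NNReal} {l : Filter ℕ} {S T : ℕ → E}
  {A B : ℝ → E}

/-- Along the filter `l` of starting indices `n`, the increment of `S` over the elapsed time `t`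
converges to `A t`. -/
def HasIncrementLimit (γ : ℕ → ℝ) (l : Filter ℕ) (S : ℕ → E) (A : ℝ → E) : Prop :=
  ∀ t, Tendsto (fun n => S (hit γ n t) - S n) l (𝓝 (A t))

lemma HasIncrementLimit.mono_left {l' : Filter ℕ} (h : HasIncrementLimit γ l S A) (hl : l' ≤ l) :
    HasIncrementLimit γ l' S A := fun t => (h t).mono_left hl

lemma HasIncrementLimit.add (hS : HasIncrementLimit γ l S A) (hT : HasIncrementLimit γ l T B) :
    HasIncrementLimit γ l (fun k => S k + T k) (fun t => A t + B t) := fun t => by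
  simpa only [add_sub_add_comm] using (hS t).add (hT t)

lemma HasIncrementLimit.lipschitzWith [l.NeBot] (hA : HasIncrementLimit γ l S A)
    (hS : IsClockLipschitz C γ S) (hγ : IsStepSize γ) (hl : l ≤ atTop) : LipschitzWith C A :=
  LipschitzWith.of_dist_le_mul fun t s => hS.le_mul_dist_of_tendsto hγ hl <| by
    simpa only [dist_sub_right] using (hA t).dist (hA s)

lemma IsClockLipschitz.exists_hasIncrementLimit [ProperSpace E] (hS : IsClockLipschitz C γ S)
    (hγ : IsStepSize γ) {U : Ultrafilter ℕ} (hU : (U : Filter ℕ) ≤ atTop) :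
    ∃ A, HasIncrementLimit γ U S A := by
  suffices hlim : ∀ t, ∃ a, Tendsto (fun n => S (hit γ n t) - S n) U (𝓝 a) from
    Classical.skolem.1 hlim
  intro t
  have hbound : ∀ᶠ n in (U : Filter ℕ),
      S (hit γ n t) - S n ∈ Metric.closedBall 0 (C * (|max t 0| + 1)) := by
    filter_upwards [hU ((hγ.tendsto_clock_hit_sub t).abs.eventually_le_const
      (lt_add_one _))] with n hn
    rw [mem_closedBall_zero_iff, ← dist_eq_norm]
    exact (hS _ _).trans (mul_le_mul_of_nonneg_left hn C.coe_nonneg)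
  obtain ⟨a, -, ha⟩ := (isCompact_closedBall (0 : E) _).ultrafilter_le_nhds
    (U.map fun n => S (hit γ n t) - S n) (le_principal_iff.2 hbound)
  exact ⟨a, ha⟩

lemma HasIncrementLimit.of_tendsto (hγ : IsStepSize γ) {a : E} (hS : Tendsto S atTop (𝓝 a)) :
    HasIncrementLimit γ atTop S 0 := fun t => by
  simpa only [sub_self, Function.comp_apply, Pi.zero_apply] using
    (hS.comp (hγ.tendsto_hit t)).sub hS

end IncrementLimit

section WeightedSumLimit

variable {E : Type*} [NormedAddCommGroup E] [NormedSpace ℝ E] {γ : ℕ → ℝ} {C : NNReal}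
  {l : Filter ℕ} {u : ℕ → E} {A : ℝ → E}

lemma IsStepSize.isClockLipschitz_weightedSum (hγ : IsStepSize γ)
    (hu : ∀ k, 1 ≤ k → ‖u k‖ ≤ C) : IsClockLipschitz C γ (weightedSum γ u) := fun a b => by
  wlog hab : a ≤ b generalizing a b
  · rw [dist_comm, dist_comm (clock γ a)]
    exact this b a (le_of_not_ge hab)
  rw [dist_comm, dist_comm (clock γ a), dist_eq_norm, Real.dist_eq,
    abs_of_nonneg (sub_nonneg.2 (hγ.clock_mono hab))]
  exact hγ.norm_weightedSum_sub_le hab fun i hi _ => hu i (by lia)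

lemma IsStepSize.exists_hasIncrementLimit_weightedSum [ProperSpace E] (hγ : IsStepSize γ)
    {U : Ultrafilter ℕ} (hU : (U : Filter ℕ) ≤ atTop) {M : ℝ} (hu : ∀ k, 1 ≤ k → ‖u k‖ ≤ M) :
    ∃ A L, HasIncrementLimit γ U (weightedSum γ u) A ∧ LipschitzWith L A := by
  have hS := hγ.isClockLipschitz_weightedSum fun k hk => (hu k hk).trans (Real.le_coe_toNNReal M)
  obtain ⟨A, hA⟩ := hS.exists_hasIncrementLimit hγ hU
  exact ⟨A, _, hA, hA.lipschitzWith hS hγ hU⟩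

lemma IsStepSize.hasIncrementLimit_weightedSum_zero (hγ : IsStepSize γ)
    (hu : Tendsto u atTop (𝓝 0)) : HasIncrementLimit γ atTop (weightedSum γ u) 0 := fun t => by
  refine Metric.tendsto_nhds.2 fun ε hε => ?_
  obtain ⟨η, hη, hηε⟩ := exists_pos_mul_lt hε (max t 0 + 1)
  have hsmall : ∀ᶠ n in atTop, ∀ i, n ≤ i → ‖u i‖ ≤ η :=
    eventually_forall_ge_atTop.2 ((tendsto_zero_iff_norm_tendsto_zero.1 hu).eventually_le_const hη)
  filter_upwards [hsmall,
    (hγ.tendsto_clock_hit_sub t).eventually_le_const (lt_add_one _)] with n hn hspan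
  rw [Pi.zero_apply, dist_zero_right]
  calc _ ≤ η * (clock γ (hit γ n t) - clock γ n) :=
        hγ.norm_weightedSum_sub_le (hγ.hit_spec n t).1 fun i hi _ => hn i hi.le
    _ ≤ η * (max t 0 + 1) := mul_le_mul_of_nonneg_left hspan hη.le
    _ < ε := by rwa [mul_comm]

lemma IsStepSize.hasIncrementLimit_weightedSum_noise (hγ : IsStepSize γ) {e r : ℕ → E} {a : E}
    (hu : ∀ k, 1 ≤ k → u k = e k + r k) (he : Tendsto (weightedSum γ e) atTop (𝓝 a))
    (hr : Tendsto r atTop (𝓝 0)) : HasIncrementLimit γ atTop (weightedSum γ u) 0 := by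
  have hsum : weightedSum γ u = fun k => weightedSum γ e k + weightedSum γ r k :=
    funext fun k => (weightedSum_congr hu k).trans (weightedSum_add γ e r k)
  have h := (HasIncrementLimit.of_tendsto hγ he).add (hγ.hasIncrementLimit_weightedSum_zero hr)
  simpa only [hsum, Pi.zero_def, add_zero] using h

variable {α : Type*} [PseudoMetricSpace α] {x : ℕ → α} {z : ℝ → α} {t : ℝ} {v : E}

lemma HasIncrementLimit.map_hasDerivAt_le [l.NeBot] (hA : HasIncrementLimit γ l (weightedSum γ u) A)
    (hz : IsLimitArc γ l x z) (hx : IsClockLipschitz C γ x) (hγ : IsStepSize γ) (hl : l ≤ atTop)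
    (ht : 0 ≤ t) (hv : HasDerivAt A v t) {φ : E →L[ℝ] ℝ} {c : ℝ}
    (hu : ∀ᶠ i in atTop ⊓ comap x (𝓝 (z t)), φ (u i) ≤ c) : φ v ≤ c := by
  obtain ⟨ρ, hρ, hwindow⟩ := hz.eventually_forall_le_hit hx hγ hl ht hu
  have hincrement : ∀ h ∈ Ioc 0 ρ, φ (A (t + h) - A t) ≤ c * h := by
    rintro h ⟨hh, hhρ⟩
    have hclock := ((hγ.tendsto_clock_hit_sub_clock_hit t (t + h)).mono_left hl).const_mul c
    rw [max_eq_left ht, max_eq_left (add_nonneg ht hh.le), add_sub_cancel_left] at hclock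
    refine le_of_tendsto_of_tendsto
      ((φ.continuous.tendsto _).comp ((hA (t + h)).sub (hA t))) hclock ?_
    filter_upwards [hwindow] with n hn
    simp only [Function.comp_apply, sub_sub_sub_cancel_right]
    exact hγ.map_weightedSum_sub_le (φ := φ.toLinearMap) (hγ.hit_mono n (by linarith))
      fun i hi hi' => hn i hi.le (hi'.trans (hγ.hit_mono n (by linarith)))
  have hslope := (hasDerivAt_iff_tendsto_slope_zero.1 hv).mono_left
    (nhdsWithin_mono 0 fun s (hs : s ∈ Ioi 0) => hs.ne')
  refine le_of_tendsto ((φ.continuous.tendsto v).comp hslope) ?_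
  filter_upwards [Ioc_mem_nhdsGT hρ] with h hh
  rw [Function.comp_apply, map_smul, smul_eq_mul, inv_mul_le_iff₀ hh.1, mul_comm]
  exact hincrement h hh

/-- The increments of `A` average the directions `u i` over short time windows, so by separation the
velocity of `A` lies in every closed convex set that contains the cluster points of these
directions. -/
lemma HasIncrementLimit.hasDerivAt_mem_of_clusterPt [ProperSpace E] [l.NeBot]
    (hA : HasIncrementLimit γ l (weightedSum γ u) A) (hz : IsLimitArc γ l x z)
    (hx : IsClockLipschitz C γ x) (hγ : IsStepSize γ) (hl : l ≤ atTop) (ht : 0 ≤ t)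
    (hv : HasDerivAt A v t) {M : ℝ} (hu : ∀ k, 1 ≤ k → ‖u k‖ ≤ M) {D : Set E}
    (hDconv : Convex ℝ D) (hDclosed : IsClosed D)
    (hD : ∀ (U : Ultrafilter ℕ) (a : E), (U : Filter ℕ) ≤ atTop → Tendsto x U (𝓝 (z t)) →
      Tendsto u U (𝓝 a) → a ∈ D) : v ∈ D := by
  by_contra hvD
  obtain ⟨φ, c, hDc, hcv⟩ := geometric_hahn_banach_closed_point hDconv hDclosed hvD
  refine hcv.not_ge (hA.map_hasDerivAt_le hz hx hγ hl ht hv (c := c) ?_)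
  refine mem_iff_ultrafilter.2 fun U hU => ?_
  have hUtop : (U : Filter ℕ) ≤ atTop := hU.trans inf_le_left
  obtain ⟨a, -, ha⟩ := (isCompact_closedBall (0 : E) M).ultrafilter_le_nhds (U.map u)
    (le_principal_iff.2 (hUtop ((eventually_ge_atTop 1).mono fun k hk =>
      mem_closedBall_zero_iff.2 (hu k hk))))
  have haD : a ∈ D := hD U a hUtop (tendsto_iff_comap.2 (hU.trans inf_le_right)) ha
  exact ((φ.continuous.tendsto a).comp ha).eventually_le_const (hDc a haD)

end WeightedSumLimit

section DescentArc

variable {E : Type*} [NormedAddCommGroup E] [InnerProductSpace ℝ E] {g : E → ℝ} {K : Set E} {p : E}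

lemma convex_clarkeGradient (g : E → ℝ) (p : E) : Convex ℝ (clarkeGradient g p) := by
  rw [clarkeGradient, ofPred_forall]
  exact convex_iInter fun h => convex_halfSpace_le (innerₛₗ ℝ h).isLinear _

lemma isClosed_clarkeGradient (g : E → ℝ) (p : E) : IsClosed (clarkeGradient g p) := by
  rw [clarkeGradient, ofPred_forall]
  exact isClosed_iInter fun h => isClosed_le (by fun_prop) continuous_const

lemma convex_normalCone (K : Set E) (p : E) : Convex ℝ (normalCone K p) := by
  simp only [normalCone, ofPred_forall]
  refine convex_iInter₂ fun y _ => ?_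
  simp only [real_inner_comm (y - p)]
  exact convex_halfSpace_le (innerₛₗ ℝ (y - p)).isLinear 0

lemma isClosed_normalCone (K : Set E) (p : E) : IsClosed (normalCone K p) := by
  simp only [normalCone, ofPred_forall]
  exact isClosed_biInter fun y _ => isClosed_le (by fun_prop) continuous_const

lemma mem_normalCone_of_tendsto {ι : Type*} {F : Filter ι} [F.NeBot] {y ν : ι → E} {v : E}
    (hy : Tendsto y F (𝓝 p)) (hν : Tendsto ν F (𝓝 v)) (hmem : ∀ᶠ i in F, ν i ∈ normalCone K (y i)) :
    v ∈ normalCone K p := fun q hq =>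
  le_of_tendsto (hν.inner (tendsto_const_nhds.sub hy)) (hmem.mono fun _ hi => hi q hq)

variable {γ : ℕ → ℝ} {l : Filter ℕ} {C : NNReal} {x : ℕ → E} {z A : ℝ → E} {t M : ℝ} {v : E}

lemma HasIncrementLimit.hasDerivAt_eq_of_continuousOn [ProperSpace E] [l.NeBot] {G : E → E}
    (hA : HasIncrementLimit γ l (weightedSum γ fun k => G (x (k - 1))) A)
    (hz : IsLimitArc γ l x z) (hx : IsClockLipschitz C γ x) (hγ : IsStepSize γ) (hl : l ≤ atTop)
    (ht : 0 ≤ t) (hv : HasDerivAt A v t) (hG : ContinuousOn G K) (hxK : ∀ k, x k ∈ K)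
    (hzK : z t ∈ K) (hM : ∀ k, 1 ≤ k → ‖G (x (k - 1))‖ ≤ M) : v = G (z t) := by
  refine hA.hasDerivAt_mem_of_clusterPt hz hx hγ hl ht hv hM (convex_singleton _)
    isClosed_singleton fun U a hU hxU ha => ?_
  have hpred : Tendsto (fun k => x (k - 1)) U (𝓝[K] (z t)) :=
    tendsto_nhdsWithin_iff.2 ⟨hxU.congr_dist ((hx.tendsto_dist_pred hγ).mono_left hU),
      Eventually.of_forall fun k => hxK _⟩
  exact tendsto_nhds_unique ha ((hG _ hzK).tendsto.comp hpred)

lemma HasIncrementLimit.hasDerivAt_mem_clarkeGradient [ProperSpace E] [l.NeBot] {y ζ : ℕ → E}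
    (hA : HasIncrementLimit γ l (weightedSum γ ζ) A) (hz : IsLimitArc γ l x z)
    (hx : IsClockLipschitz C γ x) (hγ : IsStepSize γ) (hl : l ≤ atTop) (ht : 0 ≤ t)
    (hv : HasDerivAt A v t) (hg : LipschitzNear g (z t)) (hM : ∀ k, 1 ≤ k → ‖ζ k‖ ≤ M)
    (hζ : ∀ k, 1 ≤ k → ζ k ∈ clarkeGradient g (y k))
    (hyx : Tendsto (fun k => dist (x k) (y k)) atTop (𝓝 0)) : v ∈ clarkeGradient g (z t) :=
  hA.hasDerivAt_mem_of_clusterPt hz hx hγ hl ht hv hM (convex_clarkeGradient g _)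
    (isClosed_clarkeGradient g _) fun _ _ hU hxU ha =>
      mem_clarkeGradient_of_tendsto hg (hxU.congr_dist (hyx.mono_left hU)) ha
        (hU ((eventually_ge_atTop 1).mono hζ))

lemma HasIncrementLimit.hasDerivAt_mem_normalCone [ProperSpace E] [l.NeBot] {ν : ℕ → E}
    (hA : HasIncrementLimit γ l (weightedSum γ ν) A) (hz : IsLimitArc γ l x z)
    (hx : IsClockLipschitz C γ x) (hγ : IsStepSize γ) (hl : l ≤ atTop) (ht : 0 ≤ t)
    (hv : HasDerivAt A v t) (hM : ∀ k, 1 ≤ k → ‖ν k‖ ≤ M)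
    (hν : ∀ k, 1 ≤ k → ν k ∈ normalCone K (x k)) : v ∈ normalCone K (z t) :=
  hA.hasDerivAt_mem_of_clusterPt hz hx hγ hl ht hv hM (convex_normalCone K _)
    (isClosed_normalCone K _) fun _ _ hU hxU ha =>
      mem_normalCone_of_tendsto hxU ha (hU ((eventually_ge_atTop 1).mono hν))

/-- A Lipschitz arc in `K` solving, at almost every time `t > 0`, the differential inclusion
`-z' t ∈ G (z t) + ∂g (z t) + N_K (z t)`. -/
structure IsDescentArc (K : Set E) (G : E → E) (g : E → ℝ) (z : ℝ → E) : Prop where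
  lipschitz : ∃ L, LipschitzWith L z
  mem : ∀ t, z t ∈ K
  inclusion : ∀ᵐ t : ℝ, 0 < t → ∃ ζ ∈ clarkeGradient g (z t), ∃ ν ∈ normalCone K (z t),
    HasDerivAt z (-(G (z t) + ζ + ν)) t

omit [InnerProductSpace ℝ E] in
lemma IsLimitArc.eq_sub_of_hasIncrementLimit [l.NeBot] {S : ℕ → E} {x₀ : E}
    (hz : IsLimitArc γ l x z) (hγ : IsStepSize γ) (hA : HasIncrementLimit γ l S A)
    (hxS : ∀ k, x k = x₀ - S k) (t : ℝ) : z t = z 0 - A t := by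
  refine tendsto_nhds_unique (hz t) (((hz.tendsto_start hγ).sub (hA t)).congr fun n => ?_)
  rw [hxS n, hxS (hit γ n t)]
  abel

lemma isClockLipschitz_of_isInclusionStep {H : ℕ → E} {C : ℝ} (hγ : IsStepSize γ)
    (hstep : ∀ k, 1 ≤ k → IsInclusionStep K g C (γ k) (x (k - 1)) (H k) (x k)) :
    IsClockLipschitz (C + C + C).toNNReal γ x := by
  choose! _ hH y ζ ν hx _ _ hζ hν _ using hstep
  intro a b
  rw [eq_sub_weightedSum hx a, eq_sub_weightedSum hx b, dist_sub_left]
  refine hγ.isClockLipschitz_weightedSum (fun k hk => ?_) a b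
  exact norm_add₃_le.trans ((add_le_add_three (hH k hk) (hζ k hk) (hν k hk)).trans
    (Real.le_coe_toNNReal _))

/-- The steps `H k` are split into `G (x (k - 1))`, whose limit velocity is `G (z t)`, and the
noise, which does not contribute. -/
lemma exists_isDescentArc [FiniteDimensional ℝ E] {G : E → E} {H : ℕ → E} {C : ℝ}
    {U : Ultrafilter ℕ} (hγ : IsStepSize γ) (hU : (U : Filter ℕ) ≤ atTop) (hK : IsCompact K)
    (hG : ContinuousOn G K) (hg : ∀ p ∈ K, LipschitzNear g p) (hxK : ∀ k, x k ∈ K)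
    (hstep : ∀ k, 1 ≤ k → IsInclusionStep K g C (γ k) (x (k - 1)) (H k) (x k))
    (hnoise : HasIncrementLimit γ atTop (weightedSum γ fun k => H k - G (x (k - 1))) 0) :
    ∃ z, IsLimitArc γ U x z ∧ IsDescentArc K G g z := by
  have hx := isClockLipschitz_of_isInclusionStep hγ hstep
  obtain ⟨z, hzK, hz⟩ := exists_isLimitArc_of_isCompact (γ := γ) hK hxK U
  obtain ⟨M, hM⟩ := hK.exists_bound_of_continuousOn hG
  choose! _ _ y ζ ν hxs hζ hν hζC hνC hy using hstep
  have hGM : ∀ k, 1 ≤ k → ‖G (x (k - 1))‖ ≤ M := fun k _ => hM _ (hxK _)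
  obtain ⟨D, _, hD, hDlip⟩ := hγ.exists_hasIncrementLimit_weightedSum hU hGM
  obtain ⟨A, _, hA, hAlip⟩ := hγ.exists_hasIncrementLimit_weightedSum hU hζC
  obtain ⟨B, _, hB, hBlip⟩ := hγ.exists_hasIncrementLimit_weightedSum hU hνC
  have hzeq : z = fun t => z 0 - (D t + A t + B t) := by
    refine funext fun t => ?_
    have hsum := ((hD.add (hnoise.mono_left hU)).add hA).add hB
    rw [hz.eq_sub_of_hasIncrementLimit hγ hsum (x₀ := x 0) (fun k => ?_) t, Pi.zero_apply, add_zero]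
    rw [eq_sub_weightedSum hxs k, ← weightedSum_add, ← weightedSum_add, ← weightedSum_add]
    congr 2
    ext i
    simp only [Pi.add_apply, add_sub_cancel]
  have hyx : Tendsto (fun k => dist (x k) (y k)) atTop (𝓝 0) := by
    refine squeeze_zero' (Eventually.of_forall fun _ => dist_nonneg) ?_
      (by simpa only [mul_zero] using hγ.tendsto_zero.const_mul C)
    filter_upwards [eventually_ge_atTop 1] with k hk
    simpa only [dist_comm (x k), dist_eq_norm] using hy k hk
  refine ⟨z, hz, ⟨_, hz.lipschitzWith hx hγ hU⟩, hzK, ?_⟩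
  filter_upwards [hDlip.ae_differentiableAt_real, hAlip.ae_differentiableAt_real,
    hBlip.ae_differentiableAt_real] with t hDt hAt hBt ht
  refine ⟨deriv A t, hA.hasDerivAt_mem_clarkeGradient hz hx hγ hU ht.le hAt.hasDerivAt
    (hg _ (hzK t)) hζC hζ hyx, deriv B t, hB.hasDerivAt_mem_normalCone hz hx hγ hU ht.le
    hBt.hasDerivAt hνC hν, ?_⟩
  rw [← hD.hasDerivAt_eq_of_continuousOn hz hx hγ hU ht.le hDt.hasDerivAt hG hxK (hzK t) hGM]
  conv => arg 1; rw [hzeq]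
  exact ((hDt.hasDerivAt.add hAt.hasDerivAt).add hBt.hasDerivAt).const_sub (z 0)

end DescentArc

section Lyapunov

open MeasureTheory

lemma antitoneOn_Ici_of_ae_deriv_nonpos {φ : ℝ → ℝ} {M : NNReal} {a : ℝ} (hφ : LipschitzWith M φ)
    (h : ∀ᵐ t, a < t → deriv φ t ≤ 0) : AntitoneOn φ (Ici a) := by
  intro s hs t _ hst
  have hftc := (hφ.lipschitzOnWith (s := uIcc s t)).absolutelyContinuousOnInterval
    |>.integral_deriv_eq_sub
  have hint : 0 ≤ ∫ u in s..t, -deriv φ u := by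
    refine intervalIntegral.integral_nonneg_of_ae_restrict hst ?_
    rw [EventuallyLE, ae_restrict_iff' measurableSet_Icc]
    filter_upwards [h, Measure.ae_ne volume a] with u hu hua hus
    exact neg_nonneg.2 (hu (lt_of_le_of_ne (le_trans hs hus.1) hua.symm))
  rwa [intervalIntegral.integral_neg, hftc, neg_sub, sub_nonneg] at hint

variable {E : Type*} [NormedAddCommGroup E] [InnerProductSpace ℝ E] {K : Set E} {f g : E → ℝ}
  {z : ℝ → E} {L : NNReal} {t D : ℝ} {w ζ ν : E}

lemma inner_hasDerivAt_eq_zero_of_mem_normalCone (hzK : ∀ s, z s ∈ K) (hz : HasDerivAt z w t)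
    (hν : ν ∈ normalCone K (z t)) : inner ℝ ν w = 0 := by
  have hmax : IsLocalMax (fun s => inner ℝ ν (z s)) t := Eventually.of_forall fun s => by
    rw [← sub_nonpos, ← inner_sub_right]
    exact hν _ (hzK s)
  exact hmax.hasDerivAt_eq_zero ((innerSL ℝ ν).hasFDerivAt.comp_hasDerivAt t hz)

variable [CompleteSpace E]

lemma deriv_add_comp_eq_neg_norm_sq (hf : DifferentiableAt ℝ f (z t)) (hg : RegularAt g (z t))
    (hzK : ∀ s, z s ∈ K) (hζ : ζ ∈ clarkeGradient g (z t)) (hν : ν ∈ normalCone K (z t))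
    (hz : HasDerivAt z (-(gradient f (z t) + ζ + ν)) t)
    (hD : HasDerivAt (fun s => f (z s) + g (z s)) D t) :
    D = -‖gradient f (z t) + ζ + ν‖ ^ 2 := by
  have hfz : HasDerivAt (f ∘ z) (inner ℝ (gradient f (z t)) (-(gradient f (z t) + ζ + ν))) t := by
    simpa only [InnerProductSpace.toDual_apply_apply] using
      hf.hasGradientAt.hasFDerivAt.comp_hasDerivAt t hz
  have hgz := hg.deriv_comp_eq_inner hz
    ((hD.sub hfz).congr_of_eventuallyEq (Eventually.of_forall fun s => by simp)) hζ
  have hνz := inner_hasDerivAt_eq_zero_of_mem_normalCone hzK hz hν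
  rw [real_inner_comm ζ, sub_eq_iff_eq_add] at hgz
  rw [hgz, ← real_inner_self_eq_norm_sq, ← inner_neg_right, inner_add_left _ ν,
    inner_add_left _ ζ, hνz, add_zero, add_comm]

lemma IsDescentArc.ae_deriv_add_comp (hz : IsDescentArc K (gradient f) g z)
    (hf : ∀ y ∈ K, DifferentiableAt ℝ f y) (hg : ∀ y ∈ K, RegularAt g y) :
    ∀ᵐ t, 0 < t → ∃ w, HasDerivAt z w t ∧
      (∀ D, HasDerivAt (fun s => f (z s) + g (z s)) D t → D = -‖w‖ ^ 2) ∧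
      (w = 0 → z t ∈ stationarySet K f g) := by
  filter_upwards [hz.inclusion] with t ht ht₀
  obtain ⟨ζ, hζ, ν, hν, hzt⟩ := ht ht₀
  refine ⟨_, hzt, fun D hD => ?_, fun hw => ⟨hz.mem t, ?_⟩⟩
  · rw [norm_neg]
    exact deriv_add_comp_eq_neg_norm_sq (hf _ (hz.mem t)) (hg _ (hz.mem t)) hz.mem hζ hν hzt hD
  · rw [← neg_eq_zero.1 hw]
    exact add_mem_add (add_mem_add rfl hζ) hν

lemma IsDescentArc.antitoneOn (hz : IsDescentArc K (gradient f) g z)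
    (hL : LipschitzOnWith L (fun y => f y + g y) K) (hf : ∀ y ∈ K, DifferentiableAt ℝ f y)
    (hg : ∀ y ∈ K, RegularAt g y) : AntitoneOn (fun t => f (z t) + g (z t)) (Ici 0) := by
  obtain ⟨M, hM⟩ := hz.lipschitz
  have hlip : LipschitzWith (L * M) (fun t => f (z t) + g (z t)) :=
    lipschitzOnWith_univ.1 (hL.comp (lipschitzOnWith_univ.2 hM) fun t _ => hz.mem t)
  refine antitoneOn_Ici_of_ae_deriv_nonpos hlip ?_
  filter_upwards [hz.ae_deriv_add_comp hf hg, hlip.ae_differentiableAt_real] with t ht hdiff ht₀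
  obtain ⟨w, -, hderiv, -⟩ := ht ht₀
  rw [hderiv _ hdiff.hasDerivAt]
  exact neg_nonpos.2 (sq_nonneg _)

lemma IsDescentArc.ae_hasDerivAt_zero_of_eq (hz : IsDescentArc K (gradient f) g z)
    (hL : LipschitzOnWith L (fun y => f y + g y) K) (hf : ∀ y ∈ K, DifferentiableAt ℝ f y)
    (hg : ∀ y ∈ K, RegularAt g y) {T : ℝ} (hconst : f (z T) + g (z T) = f (z 0) + g (z 0)) :
    ∀ᵐ t, t ∈ Ioo 0 T → HasDerivAt z 0 t ∧ z t ∈ stationarySet K f g := by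
  have hanti := hz.antitoneOn hL hf hg
  filter_upwards [hz.ae_deriv_add_comp hf hg] with t ht htT
  obtain ⟨w, hw, hderiv, hstat⟩ := ht htT.1
  have hV : HasDerivAt (fun s => f (z s) + g (z s)) 0 t := by
    refine (hasDerivAt_const t (f (z 0) + g (z 0))).congr_of_eventuallyEq ?_
    filter_upwards [Ioo_mem_nhds htT.1 htT.2] with s hs
    have hsT := hanti hs.1.le (hs.1.trans hs.2).le hs.2.le
    exact (hanti self_mem_Ici hs.1.le hs.1.le).antisymm (hconst.symm.trans_le hsT)
  obtain rfl : w = 0 := norm_eq_zero.1 (sq_eq_zero_iff.1 (neg_eq_zero.1 (hderiv 0 hV).symm))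
  exact ⟨hw, hstat rfl⟩

lemma IsDescentArc.mem_stationarySet_of_eq (hz : IsDescentArc K (gradient f) g z)
    (hL : LipschitzOnWith L (fun y => f y + g y) K) (hf : ∀ y ∈ K, DifferentiableAt ℝ f y)
    (hg : ∀ y ∈ K, RegularAt g y) {T : ℝ} (hT : 0 < T)
    (hconst : f (z T) + g (z T) = f (z 0) + g (z 0)) : z 0 ∈ stationarySet K f g := by
  have hae := hz.ae_hasDerivAt_zero_of_eq hL hf hg hconst
  obtain ⟨M, hM⟩ := hz.lipschitz
  have hderiv : ∀ᵐ t, t ∈ uIcc 0 T → HasDerivAt z 0 t := by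
    filter_upwards [hae, Measure.ae_ne volume 0, Measure.ae_ne volume T] with t ht ht₀ htT hmem
    rw [uIcc_of_le hT.le] at hmem
    exact (ht ⟨hmem.1.lt_of_ne' ht₀, hmem.2.lt_of_ne htT⟩).1
  obtain ⟨c, hc⟩ := (hM.lipschitzOnWith (s := uIcc 0 T)).absolutelyContinuousOnInterval
    |>.const_of_ae_hasDerivAt_zero hderiv
  obtain ⟨t, ht, htT⟩ :=
    (Measure.dense_of_ae hae).exists_mem_open isOpen_Ioo (nonempty_Ioo.2 hT)
  rw [hc 0 left_mem_uIcc, ← hc t (Ioo_subset_Icc_self.trans Icc_subset_uIcc htT)]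
  exact (ht htT).2

end Lyapunov

section Convergence

/-- Between the steps `n` and `m` the sequence rises from at most `a` to above `b`, without
returning to the level `a` in between. -/
structure IsUpcrossing (v : ℕ → ℝ) (a b : ℝ) (n m : ℕ) : Prop where
  lt : n < m
  start_le : v n ≤ a
  lt_end : b < v m
  above : ∀ k, n < k → k ≤ m → a < v k

lemma frequently_exists_isUpcrossing {v : ℕ → ℝ} {a b : ℝ} (hab : a < b)
    (ha : ∃ᶠ n in atTop, v n < a) (hb : ∃ᶠ n in atTop, b < v n) :
    ∃ᶠ n in atTop, ∃ m, IsUpcrossing v a b n m := by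
  rw [frequently_atTop] at ha hb ⊢
  intro N
  obtain ⟨n₀, hn₀, han₀⟩ := ha N
  obtain ⟨m, hm, hbm⟩ := hb n₀
  set n := Nat.findGreatest (fun k => v k ≤ a) m
  have hna : v n ≤ a := Nat.findGreatest_spec (P := fun k => v k ≤ a) hm han₀.le
  have hnm : n ≠ m := fun h => (hab.trans hbm).not_ge (h ▸ hna)
  exact ⟨n, hn₀.trans (Nat.le_findGreatest hm han₀.le), m,
    (Nat.findGreatest_le m).lt_of_ne hnm, hna, hbm,
    fun k hk hkm => not_le.1 (Nat.findGreatest_is_greatest hk hkm)⟩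

lemma exists_ultrafilter_eventually_of_frequently {β : Type*} {l : Filter β} {p : β → Prop}
    (h : ∃ᶠ n in l, p n) :
    ∃ U : Ultrafilter β, (U : Filter β) ≤ l ∧ ∀ᶠ n in (U : Filter β), p n := by
  have := frequently_iff_neBot.1 h
  obtain ⟨U, hU⟩ := Ultrafilter.exists_le (l ⊓ 𝓟 {n | p n})
  exact ⟨U, hU.trans inf_le_left, le_principal_iff.1 (hU.trans inf_le_right)⟩

variable {α : Type*} [PseudoMetricSpace α] {K S : Set α} {V : α → ℝ} {γ : ℕ → ℝ} {C : NNReal}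
  {l : Filter ℕ} {U : Ultrafilter ℕ} {x : ℕ → α} {z : ℝ → α} {m : ℕ → ℕ} {a b T : ℝ}

/-- An arc in `K` along which the Lyapunov function `V` does not increase, and strictly decreases
from the start unless the arc starts in `S`. -/
structure IsLyapunovArc (K S : Set α) (V : α → ℝ) (z : ℝ → α) : Prop where
  mem : ∀ t, z t ∈ K
  antitoneOn : AntitoneOn (fun t => V (z t)) (Ici 0)
  mem_of_eq : ∀ T, 0 < T → V (z T) = V (z 0) → z 0 ∈ S

lemma tendsto_comp_of_continuousOn (hV : ContinuousOn V K) (hxK : ∀ k, x k ∈ K) {p : α}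
    (hp : p ∈ K) (hm : Tendsto (fun n => x (m n)) l (𝓝 p)) :
    Tendsto (fun n => V (x (m n))) l (𝓝 (V p)) :=
  (hV p hp).tendsto.comp (tendsto_nhdsWithin_iff.2 ⟨hm, Eventually.of_forall fun _ => hxK _⟩)

lemma IsLimitArc.apply_zero_eq_of_isUpcrossing [l.NeBot] (hz : IsLimitArc γ l x z)
    (hx : IsClockLipschitz C γ x) (hγ : IsStepSize γ) (hl : l ≤ atTop) (hV : ContinuousOn V K)
    (hxK : ∀ k, x k ∈ K) (hzK : z 0 ∈ K)
    (hcross : ∀ᶠ n in l, IsUpcrossing (fun k => V (x k)) a b n (m n)) : V (z 0) = a := by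
  have hstart := hz.tendsto_start hγ
  have hnext : Tendsto (fun n => x (n + 1)) l (𝓝 (z 0)) :=
    hstart.congr_dist <| by
      simpa only [Function.comp_def, Nat.add_sub_cancel, dist_comm] using
        (hx.tendsto_dist_pred hγ).comp ((tendsto_add_atTop_nat 1).mono_left hl)
  refine le_antisymm
    (le_of_tendsto (tendsto_comp_of_continuousOn hV hxK hzK (m := id) hstart) ?_)
    (ge_of_tendsto (tendsto_comp_of_continuousOn hV hxK hzK hnext) ?_)
  · filter_upwards [hcross] with n hn using hn.start_le
  · filter_upwards [hcross] with n hn using (hn.above _ n.lt_succ_self hn.lt).le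

lemma IsLimitArc.eventually_le_hit_of_isUpcrossing (hz : IsLimitArc γ l x z) (hγ : IsStepSize γ)
    (hl : l ≤ atTop) (hV : ContinuousOn V K) (hxK : ∀ k, x k ∈ K) (hzK : z T ∈ K) (hT : 0 < T)
    (hVT : V (z T) < a) (hcross : ∀ᶠ n in l, IsUpcrossing (fun k => V (x k)) a b n (m n)) :
    ∀ᶠ n in l, m n ≤ hit γ n T := by
  have hclock := (hγ.tendsto_clock_hit_sub T).mono_left hl
  rw [max_eq_left hT.le] at hclock
  filter_upwards [hcross, hclock.eventually_const_lt hT,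
    (tendsto_comp_of_continuousOn hV hxK hzK (hz T)).eventually_lt_const hVT] with n hn hpos hlt
  have hn_lt : n < hit γ n T := hγ.clock_mono.reflect_lt (sub_pos.1 hpos)
  exact le_of_not_gt fun hm => hlt.not_gt (hn.above _ hn_lt hm.le)

lemma IsLimitArc.exists_tendsto_of_le_hit (hz : IsLimitArc γ U x z) (hx : IsClockLipschitz C γ x)
    (hγ : IsStepSize γ) (hU : (U : Filter ℕ) ≤ atTop)
    (hm : ∀ᶠ n in (U : Filter ℕ), n ≤ m n ∧ m n ≤ hit γ n T) :
    ∃ s, 0 ≤ s ∧ Tendsto (fun n => x (m n)) U (𝓝 (z s)) := by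
  have hwindow : ∀ᶠ n in (U : Filter ℕ),
      clock γ (m n) - clock γ n ∈ Icc 0 (max T 0 + 1) := by
    filter_upwards [hm, hU ((hγ.tendsto_clock_hit_sub T).eventually_le_const (lt_add_one _))]
      with n hn hle
    exact ⟨sub_nonneg.2 (hγ.clock_mono hn.1),
      (sub_le_sub_right (hγ.clock_mono hn.2) _).trans hle⟩
  obtain ⟨s, hs, hslim⟩ := isCompact_Icc.ultrafilter_le_nhds
    (U.map fun n => clock γ (m n) - clock γ n) (le_principal_iff.2 hwindow)
  exact ⟨s, hs.1, hz.tendsto_of_tendsto_clock_sub hx hγ hU hs.1 hslim⟩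

/-- A limit arc along upcrossings starts on the level `a`. Unless it starts in `S`, it is below `a`
at time `1`, so the upcrossings end within bounded time and the arc also reaches the level `b > a`,
which is impossible for a nonincreasing function. -/
lemma mem_image_of_frequently_isUpcrossing (hV : ContinuousOn V K) (hxK : ∀ k, x k ∈ K)
    (hx : IsClockLipschitz C γ x) (hγ : IsStepSize γ)
    (harc : ∀ U : Ultrafilter ℕ, (U : Filter ℕ) ≤ atTop →
      ∃ z, IsLimitArc γ U x z ∧ IsLyapunovArc K S V z)
    (hab : a < b) (hcross : ∃ᶠ n in atTop, ∃ m, IsUpcrossing (fun k => V (x k)) a b n m) :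
    a ∈ V '' S := by
  obtain ⟨U, hU, hUcross⟩ := exists_ultrafilter_eventually_of_frequently hcross
  obtain ⟨m, hm⟩ := hUcross.choice
  obtain ⟨z, hz, hzV⟩ := harc U hU
  have hstart : V (z 0) = a :=
    hz.apply_zero_eq_of_isUpcrossing hx hγ hU hV hxK (hzV.mem 0) hm
  refine ⟨z 0, hzV.mem_of_eq 1 one_pos ?_, hstart⟩
  by_contra hne
  have hdecrease : V (z 1) < a :=
    hstart ▸ (hzV.antitoneOn self_mem_Ici (mem_Ici.2 zero_le_one) zero_le_one).lt_of_ne hne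
  have hend := hz.eventually_le_hit_of_isUpcrossing hγ hU hV hxK (hzV.mem 1) one_pos hdecrease hm
  obtain ⟨s, hs, hzs⟩ := hz.exists_tendsto_of_le_hit hx hγ hU
    (hm.and hend |>.mono fun n hn => ⟨hn.1.lt.le, hn.2⟩)
  have hb : b ≤ V (z s) := ge_of_tendsto (tendsto_comp_of_continuousOn hV hxK (hzV.mem s) hzs)
    (hm.mono fun n hn => hn.lt_end.le)
  have ha : V (z s) ≤ a := hstart ▸ hzV.antitoneOn self_mem_Ici hs hs
  exact hab.not_ge (hb.trans ha)

lemma exists_tendsto_lyapunov (hK : IsCompact K) (hV : ContinuousOn V K) (hxK : ∀ k, x k ∈ K)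
    (hx : IsClockLipschitz C γ x) (hγ : IsStepSize γ)
    (harc : ∀ U : Ultrafilter ℕ, (U : Filter ℕ) ≤ atTop →
      ∃ z, IsLimitArc γ U x z ∧ IsLyapunovArc K S V z)
    (hS : interior (V '' S) = ∅) : ∃ c, Tendsto (fun n => V (x n)) atTop (𝓝 c) := by
  obtain ⟨R, hR⟩ := hK.exists_bound_of_continuousOn hV
  refine tendsto_of_no_upcrossings (interior_eq_empty_iff_dense_compl.1 hS) ?_
    (isBoundedUnder_of ⟨R, fun n => (abs_le.1 (hR _ (hxK n))).2⟩)
    (isBoundedUnder_of ⟨-R, fun n => (abs_le.1 (hR _ (hxK n))).1⟩)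
  rintro a ha b - hab ⟨hfa, hfb⟩
  exact ha (mem_image_of_frequently_isUpcrossing hV hxK hx hγ harc hab
    (frequently_exists_isUpcrossing hab hfa hfb))

theorem convergesToSet_of_isLyapunovArc (hK : IsCompact K) (hV : ContinuousOn V K)
    (hxK : ∀ k, x k ∈ K) (hx : IsClockLipschitz C γ x) (hγ : IsStepSize γ)
    (harc : ∀ U : Ultrafilter ℕ, (U : Filter ℕ) ≤ atTop →
      ∃ z, IsLimitArc γ U x z ∧ IsLyapunovArc K S V z)
    (hS : interior (V '' S) = ∅) : Tendsto (fun k => Metric.infEDist (x k) S) atTop (𝓝 0) := by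
  obtain ⟨c, hc⟩ := exists_tendsto_lyapunov hK hV hxK hx hγ harc hS
  refine (tendsto_iff_ultrafilter _ _ _).2 fun U hU => ?_
  obtain ⟨z, hz, hzV⟩ := harc U hU
  have hlevel : ∀ t, V (z t) = c := fun t =>
    tendsto_nhds_unique (tendsto_comp_of_continuousOn hV hxK (hzV.mem t) (hz t))
      ((hc.comp (hγ.tendsto_hit t)).mono_left hU)
  have hmem : z 0 ∈ S := hzV.mem_of_eq 1 one_pos ((hlevel 1).trans (hlevel 0).symm)
  exact tendsto_of_tendsto_of_tendsto_of_le_of_le tendsto_const_nhds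
    (tendsto_iff_edist_tendsto_0.1 (hz.tendsto_start hγ)) (fun _ => zero_le)
    fun _ => Metric.infEDist_le_edist_of_mem hmem

end Convergence

section StationaryLimit

variable {E : Type*} [NormedAddCommGroup E] [InnerProductSpace ℝ E] {X K : Set E} {f g : E → ℝ}
  {γ : ℕ → ℝ} {x H : ℕ → E} {B C : ℝ}

lemma exists_lipschitzOnWith_add_of_isCompact (hKconv : Convex ℝ K) (hK : IsCompact K)
    (hf : ContDiffOn ℝ 1 f K) (hg : ∀ y ∈ K, LipschitzNear g y) :
    ∃ L, LipschitzOnWith L (fun y => f y + g y) K := by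
  have hg_loc : LocallyLipschitzOn K g := fun y hy =>
    let ⟨L, t, ht, hL⟩ := hg y hy
    ⟨L, t, mem_nhdsWithin_of_mem_nhds ht, hL⟩
  obtain ⟨L₁, hL₁⟩ := hf.exists_lipschitzOnWith one_ne_zero hKconv hK
  obtain ⟨L₂, hL₂⟩ := hg_loc.exists_lipschitzOnWith_of_compact hK
  exact ⟨L₁ + L₂, hL₁.add hL₂⟩

lemma continuousOn_gradient_of_contDiffOn [CompleteSpace E] (hX : IsOpen X)
    (hf : ContDiffOn ℝ 1 f X) : ContinuousOn (gradient f) X :=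
  (InnerProductSpace.toDual ℝ E).symm.continuous.comp_continuousOn
    (hf.continuousOn_fderiv_of_isOpen hX le_rfl)

lemma exists_norm_le_of_norm_gradNoise_le [CompleteSpace E] (hK : IsCompact K)
    (hf : ContinuousOn (gradient f) K) (hB : ∀ k, 1 ≤ k → ‖gradNoise f x H k‖ ≤ B) :
    ∃ M, ∀ k, 1 ≤ k → x (k - 1) ∈ K → ‖H k‖ ≤ M := by
  obtain ⟨G, hG⟩ := hK.exists_bound_of_continuousOn hf
  refine ⟨B + G, fun k hk hxk => ?_⟩
  rw [← sub_add_cancel (H k) (gradient f (x (k - 1)))]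
  exact norm_add_le_of_le (hB k hk) (hG _ hxk)

lemma IsDescentArc.isLyapunovArc [CompleteSpace E] {L : NNReal} {z : ℝ → E}
    (hz : IsDescentArc K (gradient f) g z) (hL : LipschitzOnWith L (fun y => f y + g y) K)
    (hf : ∀ y ∈ K, DifferentiableAt ℝ f y) (hg : ∀ y ∈ K, RegularAt g y) :
    IsLyapunovArc K (stationarySet K f g) (fun y => f y + g y) z where
  mem := hz.mem
  antitoneOn := hz.antitoneOn hL hf hg
  mem_of_eq _ hT h := hz.mem_stationarySet_of_eq hL hf hg hT h

theorem convergesToSet_of_isInclusionStep [FiniteDimensional ℝ E] (hX : IsOpen X) (hKX : K ⊆ X)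
    (hKconv : Convex ℝ K) (hK : IsCompact K) (hf : ContDiffOn ℝ 1 f X)
    (hg : ∀ y ∈ K, RegularAt g y) (hγ : IsStepSize γ)
    (hS : interior ((fun y => f y + g y) '' stationarySet K f g) = ∅) (hx₀ : x 0 ∈ K)
    (hnoise : HasIncrementLimit γ atTop (weightedSum γ (gradNoise f x H)) 0)
    (hstep : ∀ k, 1 ≤ k → IsInclusionStep K g C (γ k) (x (k - 1)) (H k) (x k)) :
    ConvergesToSet x (stationarySet K f g) := by
  have hfd : ∀ y ∈ K, DifferentiableAt ℝ f y := fun y hy =>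
    (hf.differentiableOn one_ne_zero).differentiableAt (hX.mem_nhds (hKX hy))
  have hxK : ∀ k, x k ∈ K := fun k =>
    k.eq_zero_or_pos.elim (fun hk => hk ▸ hx₀) fun hk => (hstep k hk).1
  obtain ⟨L, hL⟩ :=
    exists_lipschitzOnWith_add_of_isCompact hKconv hK (hf.mono hKX) fun y hy => (hg y hy).1
  refine convergesToSet_of_isLyapunovArc hK hL.continuousOn hxK
    (isClockLipschitz_of_isInclusionStep hγ hstep) hγ (fun U hU => ?_) hS
  obtain ⟨z, hz, hdescent⟩ := exists_isDescentArc hγ hU hK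
    ((continuousOn_gradient_of_contDiffOn hX hf).mono hKX) (fun y hy => (hg y hy).1) hxK hstep
    hnoise
  exact ⟨z, hz, hdescent.isLyapunovArc hL hfd hg⟩

end StationaryLimit

end ProxSGD

theorem mainTheorem5_general {E : Type*} [NormedAddCommGroup E] [InnerProductSpace ℝ E]
    [FiniteDimensional ℝ E] {X K : Set E} (hX : IsOpen X) (hKconv : Convex ℝ K)
    (hKcomp : IsCompact K) (hKX : K ⊆ X) {f g : E → ℝ} (hf : ContDiffOn ℝ 1 f X)
    (hg : ∀ y ∈ X, ProxSGD.RegularAt g y) {γ : ℕ → ℝ} (hγ_pos : ∀ k, 1 ≤ k → 0 < γ k)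
    (hγ_sum : Tendsto (fun n : ℕ => ∑ k ∈ Finset.Icc 1 n, γ k) atTop atTop)
    (hγ_lim : Tendsto γ atTop (𝓝 0))
    (hS : interior ((fun y => f y + g y) '' ProxSGD.stationarySet K f g) = ∅)
    {x H : ℕ → E} (hx₀ : x 0 ∈ K)
    (hnoise : ∃ e r : ℕ → E, (∀ k, 1 ≤ k → ProxSGD.gradNoise f x H k = e k + r k) ∧
      Tendsto (fun k => ‖r k‖) atTop (𝓝 0) ∧
      ∃ s, Tendsto (fun n : ℕ => ∑ k ∈ Finset.Icc 1 n, γ k • e k) atTop (𝓝 s))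
    (hnoise_bdd : ∃ B : ℝ, ∀ k, 1 ≤ k → ‖ProxSGD.gradNoise f x H k‖ ≤ B) :
    ((∀ k, 1 ≤ k →
        x k ∈ ProxSGD.prox X (γ k) (fun y => (g y : EReal) + ProxSGD.convexIndicator K y)
          (x (k - 1) - γ k • H k)) →
      ProxSGD.ConvergesToSet x (ProxSGD.stationarySet K f g)) ∧
    ((∃ L : NNReal, LipschitzOnWith L g X) →
      (∀ k, 1 ≤ k →
        x k ∈ ProxSGD.projSet K
          (ProxSGD.prox X (γ k) (fun y => (g y : EReal)) (x (k - 1) - γ k • H k))) →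
      ProxSGD.ConvergesToSet x (ProxSGD.stationarySet K f g)) := by
  obtain ⟨e, r, her, hr, s, hs⟩ := hnoise
  obtain ⟨B, hB⟩ := hnoise_bdd
  have hγ : ProxSGD.IsStepSize γ := ⟨fun k hk => (hγ_pos k hk).le, hγ_sum, hγ_lim⟩
  have hgK : ∀ y ∈ K, ProxSGD.RegularAt g y := fun y hy => hg y (hKX hy)
  have hnoise_lim := hγ.hasIncrementLimit_weightedSum_noise her hs
    (tendsto_zero_iff_norm_tendsto_zero.2 hr)
  obtain ⟨M, hM⟩ := ProxSGD.exists_norm_le_of_norm_gradNoise_le hKcomp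
    ((ProxSGD.continuousOn_gradient_of_contDiffOn hX hf).mono hKX) hB
  have hpred : (∀ k, 1 ≤ k → x k ∈ K) → ∀ k, x (k - 1) ∈ K := fun h k =>
    (k - 1).eq_zero_or_pos.elim (fun hk => hk ▸ hx₀) (h _)
  refine ⟨fun hx => ?_, fun ⟨L, hL⟩ hx => ?_⟩
  · obtain ⟨L, hL⟩ := ProxSGD.exists_norm_clarkeGradient_le hKcomp fun y hy => (hgK y hy).1
    have hxK := hpred fun k hk =>
      (ProxSGD.mem_and_isMinOn_of_mem_prox_add_convexIndicator hKX ⟨x 0, hx₀⟩ (hx k hk)).1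
    exact ProxSGD.convergesToSet_of_isInclusionStep hX hKX hKconv hKcomp hf hgK hγ hS hx₀
      hnoise_lim fun k hk => ProxSGD.isInclusionStep_of_mem_prox_add_convexIndicator hKX hKconv
        hgK hL (hγ_pos k hk) (hxK k) (hM k hk (hxK k)) (hx k hk)
  · have hxK := hpred fun k hk => (hx k hk).choose_spec.2.1
    exact ProxSGD.convergesToSet_of_isInclusionStep hX hKX hKconv hKcomp hf hgK hγ hS hx₀
      hnoise_lim fun k hk => ProxSGD.isInclusionStep_of_mem_projSet_prox hX hKconv hg hL
        (hγ_pos k hk) (hxK k) (hM k hk (hxK k)) (hx k hk)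

theorem mainTheorem5 (d : ℕ)
    (X K : Set (EuclideanSpace ℝ (Fin d))) (hX : IsOpen X)
    (hKconv : Convex ℝ K) (hKcomp : IsCompact K) (hKX : K ⊆ X)
    (f g : EuclideanSpace ℝ (Fin d) → ℝ)
    -- `f` is continuously differentiable; `g` is locally Lipschitz, bounded below and regular
    (hf : ContDiffOn ℝ 1 f X)
    (hg_lip : LocallyLipschitzOn X g)
    (hg_bdd : BddBelow (g '' X))
    (hg_reg : ∀ x ∈ X, ProxSGD.RegularAt g x)
    -- step sizes
    (γ : ℕ → ℝ) (hγ_pos : ∀ k : ℕ, 1 ≤ k → 0 < γ k)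
    (hγ_sum : Tendsto (fun n : ℕ => ∑ k ∈ Finset.Icc 1 n, γ k) atTop atTop)
    (hγ_lim : Tendsto γ atTop (𝓝 0))
    -- the values of `f + g` at the stationary points
    (hS : interior ((fun x => f x + g x) '' ProxSGD.stationarySet K f g) = ∅)
    -- the iterates, the gradient estimates and the noise
    (x H : ℕ → EuclideanSpace ℝ (Fin d)) (hx0 : x 0 ∈ K)
    (hnoise : ∃ e r : ℕ → EuclideanSpace ℝ (Fin d),
      (∀ k : ℕ, 1 ≤ k → ProxSGD.gradNoise f x H k = e k + r k) ∧
      Tendsto (fun k => ‖r k‖) atTop (𝓝 0) ∧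
      ∃ s, Tendsto (fun n : ℕ => ∑ k ∈ Finset.Icc 1 n, γ k • e k) atTop (𝓝 s))
    (hnoise_bdd : ∃ C : ℝ, ∀ k : ℕ, 1 ≤ k → ‖ProxSGD.gradNoise f x H k‖ ≤ C) :
    ((∀ k : ℕ, 1 ≤ k →
        x k ∈ ProxSGD.prox X (γ k) (fun y => (g y : EReal) + ProxSGD.convexIndicator K y)
          (x (k - 1) - γ k • H k)) →
      ProxSGD.ConvergesToSet x (ProxSGD.stationarySet K f g)) ∧
    ((∃ L : NNReal, LipschitzOnWith L g X) →
      (∀ k : ℕ, 1 ≤ k →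
        x k ∈ ProxSGD.projSet K
          (ProxSGD.prox X (γ k) (fun y => (g y : EReal)) (x (k - 1) - γ k • H k))) →
      ProxSGD.ConvergesToSet x (ProxSGD.stationarySet K f g)) :=
  mainTheorem5_general hX hKconv hKcomp hKX hf hg_reg hγ_pos hγ_sum hγ_lim hS hx0 hnoise
    hnoise_bdd
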